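/- **Setting.** In online bin covering, items of an input sequence $\sigma$ of length $n$, with sizes in $]0,1[$, arrive one by one, and each has to be put into a bin at once and irrevocably. A bin is covered if its items have total size at least $1$. $|\mathrm{OPT}(\sigma)|$ is the maximum number of bins that can be covered with the items of $\sigma$. A strategy with advice is deterministic and may read bits from an unbounded tape written by an oracle that knows $\sigma$ and the strategy; its advice complexity is the number of bits read. Items of size at least $1/2$ are 2-items, the others are small. Dual Next Fit (DNF) fills one active bin until it is covered, then opens the next one. **The strategy $\mathrm{DH}_2^b$.** The strategy reads the number $b$ in self-delimiting form, then a constant number of selection bits, integers $r, g, x_L, x_R, \mu, \eta$, each given by $b$ significant bits and a $b$-bit exponent, and fixed point values $\bar d$ and $\underline s<\overline s=\underline s+2^{-b}$ with $b$ fractional bits. One selection bit may tell it to pack 2-items and small items separately, each class by DNF. Otherwise it opens $r$ reserved bins and proceeds as follows. *2-items.* The sequence of 2-items is split into three subsequences of length $r$ and a last one with the rest; the last one is split into chunks of lengths $x_L$, $x_R$ and the rest. "Separate bins" are packed by DNF, i.e. two by two. The selection bits choose one of these cases. 1. One of the first three subsequences is placed in the reserved bins, one item per bin; then the largest $g-1$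 of these items are declared good, and the following 2-items are added to reserved bins whose 2-item was not declared good, until each of these has two. All other 2-items go to separate bins. 2. (a) The first two chunks of the last subsequence are treated as the chosen subsequence in case 1. (b) The first chunk is placed singly in reserved bins, the largest $g$ of its items are declared good, the second chunk is used to complete the reserved bins whose 2-item was not declared good, its remaining items go to separate bins, and the third chunk goes singly into the remaining reserved bins. (c) The second and third chunks go singly into reserved bins. All other 2-items (and those for which there is no reserved bin left) go to separate bins. *Small items.* Small items of size at least $\bar d$ are black, the others white. Of the reserved bins, $\mu$ (at most $r$) are black reserved bins, which receive one black item each: any black item of size at most $\underline s$, and at most $\eta$ items of size in $]\underline s,\overline s]$. White items are placed, by Dual Worst Fit, in the other reserved bin that contains the least amount of white items, until each of these contains white items of total size at least $\bar d$. All other small items are packed by DNF in separate bins. **Theorem.** With $b=\lceil 2\log\log n\rceil$ (for $n\le 2$, $b=0$), the strategy $\mathrm{DH}_2^{b}$ uses $O(\log\log n)$ bits of advice and has asymptotic competitive ratio at least $135/242-O(1/\log n)$, where $135/242\approx 0.5578$. That is, there are functions $f(n)=O(\log\log n)$ and $e(n)=O(1/\log n)$ and a constant $C$ such that for every input sequence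 $\sigma$, with $n=|\sigma|$, the oracle can write a tape, beginning with the self-delimiting code of $b$, on which the strategy reads at most $f(n)$ bits and covers at least $$\Bigl(\frac{135}{242}-e(n)\Bigr)\,|\mathrm{OPT}(\sigma)|-C$$ bins. -/

import Mathlib

open Filter Asymptotics

namespace BinCovering

noncomputable section

/-! ### Bin covering -/

/-- An input sequence of online bin covering: all items lie strictly between 0 and 1. -/
def IsInput (σ : List ℝ) : Prop := ∀ v ∈ σ, 0 < v ∧ v < 1

open Classical in
/-- Total size of the items that the placement `f` puts into bin `j`. -/
def load {β : Type} (σ : List ℝ) (f : Fin σ.length → β) (j : β) : ℝ :=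
  ∑ i : Fin σ.length, if f i = j then σ.get i else 0

open Classical in
/-- Number of bins covered by the placement `f` (bins that receive no item are never covered). -/
def numCovered {β : Type} (σ : List ℝ) (f : Fin σ.length → β) : ℕ :=
  ((Finset.univ.image f).filter fun j => 1 ≤ load σ f j).card

/-- The optimum: the maximum number of bins covered by any placement of all the items
(a placement uses at most `σ.length` bins). -/
def opt (σ : List ℝ) : ℕ :=
  (Finset.univ : Finset (Fin σ.length → Fin σ.length)).sup fun f => numCovered σ f

/-! ### Online strategies with an advice tape -/

/-- An unbounded advice tape. -/
abbrev Tape := ℕ → Bool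

/-- A deterministic online strategy reading an advice tape, with bins named by elements of `β`.
`place t h v` is the bin that receives item `v` when the items `h` arrived before it, and
`bitsRead t h` is the number of tape bits read while the items `h` were served (`⊤` if the reading
never ends). All behaviour is determined by the bits that have been read. -/
structure AdviceStrategy (β : Type) where
  place : Tape → List ℝ → ℝ → β
  bitsRead : Tape → List ℝ → ℕ∞
  bitsRead_mono : ∀ t h v, bitsRead t h ≤ bitsRead t (h ++ [v])
  bitsRead_congr : ∀ t u h, (∀ i : ℕ, (i : ℕ∞) < bitsRead t h → t i = u i) →
    bitsRead u h = bitsRead t h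
  place_congr : ∀ t u h v, (∀ i : ℕ, (i : ℕ∞) < bitsRead t (h ++ [v]) → t i = u i) →
    place u h v = place t h v

/-- The placement produced by the strategy on the input `σ` with advice tape `t`. -/
def AdviceStrategy.placement {β : Type} (A : AdviceStrategy β) (t : Tape) (σ : List ℝ) :
    Fin σ.length → β :=
  fun i => A.place t (σ.take i) (σ.get i)

/-- Number of bins covered by the strategy on the input `σ` with advice tape `t`. -/
def AdviceStrategy.covered {β : Type} (A : AdviceStrategy β) (t : Tape) (σ : List ℝ) : ℕ :=
  numCovered σ (A.placement t σ)

/-! ### Dual Next Fit -/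

/-- State of Dual Next Fit: index and content of the active bin. -/
structure DNF where
  active : ℕ
  content : ℝ

/-- Dual Next Fit puts the item `v` into the active bin; if this covers the bin, the next bin is
opened. -/
def DNF.insert (s : DNF) (v : ℝ) : DNF :=
  if 1 ≤ s.content + v then ⟨s.active + 1, 0⟩ else ⟨s.active, s.content + v⟩

/-! ### The advice of the modified Dual Harmonic strategy -/

/-- The advice values, after decoding. -/
structure Advice where
  /-- use the strategy without advice (both item classes are packed by Dual Next Fit) -/
  plain : Bool
  /-- which of the four consecutive subsequences of 2-items is to use the reserved bins:
  0, 1, 2 are those of length `reserved`, 3 is the last one -/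
  part : ℕ
  /-- treatment of the three chunks of the last subsequence: 0 = the first two chunks go singly into
  reserved bins, and the third is matched with those not declared good; 1 = the first chunk goes
  singly into reserved bins, the second is matched with those not declared good, and the third goes
  singly into the remaining reserved bins; otherwise the first chunk goes pairwise into separate
  bins, and the other two go singly into reserved bins -/
  variant : ℕ
  /-- number of reserved bins -/
  reserved : ℕ
  /-- approximate number of 2-items to be declared good -/
  good : ℕ
  /-- length of the first chunk of the last subsequence -/
  chunkL : ℕ
  /-- length of the second chunk of the last subsequence -/
  chunkR : ℕ
  /-- number of black reserved bins -/
  black : ℕ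
  /-- number of black items of size in `]sDown, sUp]` that may go to black reserved bins -/
  blackExtra : ℕ
  /-- small items of size at least `dUp` are black, the others are white -/
  dUp : ℝ
  sDown : ℝ
  sUp : ℝ

/-- The number written (least significant bit first) in the `len` cells from `start` on. -/
def natAt (t : Tape) (start len : ℕ) : ℕ :=
  ∑ i ∈ Finset.range len, if t (start + i) then 2 ^ i else 0

/-- A `b`-bit approximate integer: `b` significant bits, followed by a `b`-bit exponent. -/
def approxAt (b : ℕ) (t : Tape) (start : ℕ) : ℕ :=
  natAt t start b * 2 ^ natAt t (start + b) b

/-- Decoding of the advice with approximation parameter `b`: five selection bits, six approximate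
integers, and two sizes given by `b` fractional bits, which determine a lower and an upper
approximation at distance `1 / 2 ^ b`. -/
def decode (b : ℕ) (t : Tape) : Advice where
  plain := t 0
  part := natAt t 1 2
  variant := natAt t 3 2
  reserved := approxAt b t 5
  good := approxAt b t (5 + 2 * b)
  chunkL := approxAt b t (5 + 4 * b)
  chunkR := approxAt b t (5 + 6 * b)
  black := approxAt b t (5 + 8 * b)
  blackExtra := approxAt b t (5 + 10 * b)
  dUp := ((natAt t (5 + 12 * b) b : ℝ) + 1) / 2 ^ b
  sDown := (natAt t (5 + 13 * b) b : ℝ) / 2 ^ b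
  sUp := ((natAt t (5 + 13 * b) b : ℝ) + 1) / 2 ^ b

/-- Number of bits used by `decode b`. -/
def adviceLength (b : ℕ) : ℕ := 5 + 14 * b

namespace Advice

/-- Number of black reserved bins (at most all the reserved bins). -/
def numBlack (p : Advice) : ℕ := min p.black p.reserved

/-- The 2-items with (zero-based) index in `[fillStart, fillEnd)` are put into reserved bins,
one per bin, after which the largest `declared` of them are declared good. -/
def fillStart (p : Advice) : ℕ :=
  if p.part < 3 then p.part * p.reserved
  else if p.variant < 2 then 3 * p.reserved
  else 3 * p.reserved + p.chunkL

/-- See `fillStart`. -/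
def fillEnd (p : Advice) : ℕ :=
  if p.part < 3 then (p.part + 1) * p.reserved
  else if p.variant = 0 then 3 * p.reserved + p.chunkL + p.chunkR
  else 3 * p.reserved + p.chunkL

/-- From this index on, the 2-items are again put, one per bin, into the remaining reserved bins. -/
def resume (p : Advice) : ℕ∞ :=
  if p.part < 3 then ⊤
  else if p.variant = 0 then ⊤
  else if p.variant = 1 then ((3 * p.reserved + p.chunkL + p.chunkR : ℕ) : ℕ∞)
  else ((3 * p.reserved + p.chunkL : ℕ) : ℕ∞)

/-- The number of 2-items that are declared good. -/
def declared (p : Advice) : ℕ :=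
  if p.part < 3 ∨ p.variant = 0 then p.good - 1 else p.good

end Advice

/-! ### The modified Dual Harmonic strategy -/

/-- Names of bins: the reserved bins, the separate bins for 2-items and those for small items. -/
inductive Bin
  | reserved (i : ℕ)
  | two (i : ℕ)
  | small (i : ℕ)

/-- State of the strategy. -/
structure State where
  /-- number of 2-items seen -/
  twoSeen : ℕ
  /-- entry `i` is the size of the first 2-item put into reserved bin `i` -/
  firsts : List ℝ
  /-- number of reserved bins that have received a second 2-item -/
  matched : ℕ
  /-- Dual Next Fit on the separate bins for 2-items -/
  twoBins : DNF
  /-- Dual Next Fit on the separate bins for small items -/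
  smallBins : DNF
  /-- amount of white items in the reserved bins -/
  white : ℕ → ℝ
  /-- number of black items in black reserved bins -/
  blackUsed : ℕ
  /-- number of those of size in `]sDown, sUp]` -/
  extraUsed : ℕ

/-- The initial state. -/
def State.start : State := ⟨0, [], 0, ⟨0, 0⟩, ⟨0, 0⟩, fun _ => 0, 0, 0⟩

open Classical in
/-- Number of entries of `l` that precede entry `i` in descending order of size, ties being broken
by position. -/
def rank (l : List ℝ) (i : ℕ) : ℕ :=
  ((Finset.range l.length).filter fun j =>
    l.getD i 0 < l.getD j 0 ∨ (l.getD i 0 = l.getD j 0 ∧ j < i)).card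

/-- Positions, in increasing order, of the entries of `l` that are not among the `g` largest. -/
def nonGood (g : ℕ) (l : List ℝ) : List ℕ :=
  (List.range l.length).filter fun i => g ≤ rank l i

/-- Put a small item into a separate bin. -/
def placeSmallSeparate (s : State) (v : ℝ) : Bin × State :=
  (.small s.smallBins.active, { s with smallBins := s.smallBins.insert v })

/-- Put a 2-item into a separate bin; Dual Next Fit packs these items two by two. -/
def placeTwoSeparate (s : State) (v : ℝ) : Bin × State :=
  (.two s.twoBins.active,
    { s with twoSeen := s.twoSeen + 1, twoBins := s.twoBins.insert v })

/-- Placing a black item: the first `numBlack` reserved bins receive one black item each, of size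
at most `sDown`, or, at most `blackExtra` times, of size in `]sDown, sUp]`. -/
def placeBlack (p : Advice) (s : State) (v : ℝ) : Bin × State :=
  if s.blackUsed < p.numBlack ∧ v ≤ p.sDown then
    (.reserved s.blackUsed, { s with blackUsed := s.blackUsed + 1 })
  else if s.blackUsed < p.numBlack ∧ v ≤ p.sUp ∧ s.extraUsed < p.blackExtra then
    (.reserved s.blackUsed,
      { s with blackUsed := s.blackUsed + 1, extraUsed := s.extraUsed + 1 })
  else placeSmallSeparate s v

/-- Placing a white item by Dual Worst Fit: it goes to a white reserved bin with the least amount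
of white items, until all these bins contain at least `dUp` of them. -/
def placeWhite (p : Advice) (s : State) (v : ℝ) : Bin × State :=
  match ((List.range p.reserved).filter fun i => p.numBlack ≤ i).argmin s.white with
  | none => placeSmallSeparate s v
  | some i =>
    if s.white i < p.dUp then
      (.reserved i, { s with white := Function.update s.white i (s.white i + v) })
    else placeSmallSeparate s v

/-- Placing a small item. -/
def placeSmall (p : Advice) (s : State) (v : ℝ) : Bin × State :=
  if p.plain then placeSmallSeparate s v
  else if p.dUp ≤ v then placeBlack p s v
  else placeWhite p s v

/-- Placing a 2-item. -/
def placeTwo (p : Advice) (s : State) (v : ℝ) : Bin × State :=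
  if p.plain then placeTwoSeparate s v
  else if ((p.fillStart ≤ s.twoSeen ∧ s.twoSeen < p.fillEnd) ∨ p.resume ≤ (s.twoSeen : ℕ∞)) ∧
      s.firsts.length < p.reserved then
    (.reserved s.firsts.length,
      { s with twoSeen := s.twoSeen + 1, firsts := s.firsts ++ [v] })
  else if p.fillEnd ≤ s.twoSeen ∧ (s.twoSeen : ℕ∞) < p.resume ∧
      s.matched < (nonGood p.declared s.firsts).length then
    (.reserved ((nonGood p.declared s.firsts).getD s.matched 0),
      { s with twoSeen := s.twoSeen + 1, matched := s.matched + 1 })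
  else placeTwoSeparate s v

/-- One step of the strategy: the bin chosen for the item `v`, and the new state. -/
def step (p : Advice) (s : State) (v : ℝ) : Bin × State :=
  if v < 1 / 2 then placeSmall p s v else placeTwo p s v

/-- The state after serving the items `h`. -/
def stateAfter (p : Advice) (h : List ℝ) : State :=
  h.foldl (fun s v => (step p s v).2) State.start

/-! ### Reading the approximation parameter -/

/-- The tape that starts with the self-delimiting (unary) code `1…10` of `b` and goes on with
`t`. -/
def selfDelimited (b : ℕ) (t : Tape) : Tape :=
  fun i => if i < b then true else if i = b then false else t (i - (b + 1))

/-- The approximation parameter written at the beginning of the tape. -/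
def width (t : Tape) : ℕ := sInf {i | t i = false}

/-- The advice decoded from a tape: first the parameter `b`, then the values. -/
def readAdvice (t : Tape) : Advice := decode (width t) fun i => t (width t + 1 + i)

open Classical in
/-- Number of bits read by `readAdvice`. -/
def readLength (t : Tape) : ℕ∞ :=
  if ∃ i, t i = false then ((width t + 1 + adviceLength (width t) : ℕ) : ℕ∞) else ⊤

theorem natAt_congr {t u : Tape} {start len : ℕ}
    (h : ∀ i, i < start + len → t i = u i) : natAt u start len = natAt t start len := by
  unfold natAt
  refine Finset.sum_congr rfl fun i hi => ?_
  rw [h (start + i) (by have := Finset.mem_range.1 hi; omega)]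

theorem decode_congr {b : ℕ} {t u : Tape} (h : ∀ i, i < adviceLength b → t i = u i) :
    decode b u = decode b t := by
  unfold adviceLength at h
  have hn : ∀ s l, s + l ≤ 5 + 14 * b → natAt u s l = natAt t s l := fun s l hs =>
    natAt_congr fun i hi => h i (by omega)
  have ha : ∀ s, s + 2 * b ≤ 5 + 14 * b → approxAt b u s = approxAt b t s := fun s hs => by
    unfold approxAt
    rw [hn s b (by omega), hn (s + b) b (by omega)]
  unfold decode
  rw [h 0 (by omega), hn 1 2 (by omega), hn 3 2 (by omega), ha 5 (by omega),
    ha (5 + 2 * b) (by omega), ha (5 + 4 * b) (by omega), ha (5 + 6 * b) (by omega),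
    ha (5 + 8 * b) (by omega), ha (5 + 10 * b) (by omega), hn (5 + 12 * b) b (by omega),
    hn (5 + 13 * b) b (by omega)]

theorem width_congr {t u : Tape} (ht : ∃ i, t i = false) (h : ∀ i, i ≤ width t → t i = u i) :
    u (width t) = false ∧ width u = width t := by
  have h0 : t (width t) = false := Nat.sInf_mem (s := {i | t i = false}) ht
  have h1 : u (width t) = false := by rw [← h _ le_rfl]; exact h0
  have h2 : width u ≤ width t := Nat.sInf_le (s := {i | u i = false}) h1
  have h3 : u (width u) = false := Nat.sInf_mem (s := {i | u i = false}) ⟨_, h1⟩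
  have h4 : width t ≤ width u :=
    Nat.sInf_le (s := {i | t i = false}) (by
      change t (width u) = false
      rw [h _ h2]; exact h3)
  exact ⟨h1, le_antisymm h2 h4⟩

theorem read_congr {t u : Tape} (h : ∀ i : ℕ, (i : ℕ∞) < readLength t → t i = u i) :
    readLength u = readLength t ∧ readAdvice u = readAdvice t := by
  by_cases ht : ∃ i, t i = false
  · have h' : ∀ i, i < width t + 1 + adviceLength (width t) → t i = u i := fun i hi => by
      refine h i ?_
      rw [readLength, if_pos ht]
      exact_mod_cast hi
    obtain ⟨h1, h2⟩ := width_congr ht fun i hi => h' i (by omega)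
    constructor
    · rw [readLength, readLength, if_pos ht, if_pos ⟨_, h1⟩, h2]
    · unfold readAdvice
      rw [h2]
      exact decode_congr fun i hi => h' _ (by omega)
  · have hu : t = u := funext fun i => h i (by
      rw [readLength, if_neg ht]
      exact ENat.natCast_lt_top i)
    rw [hu]
    exact ⟨rfl, rfl⟩

/-- The modified Dual Harmonic strategy with two item classes. It reads its advice, beginning with
the number of bits `b` used for the approximations, before the first item is served. -/
def modifiedDualHarmonic : AdviceStrategy Bin where
  place t h v := (step (readAdvice t) (stateAfter (readAdvice t) h) v).1
  bitsRead t _ := readLength t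
  bitsRead_mono _ _ _ := le_rfl
  bitsRead_congr _ _ _ h := (read_congr h).1
  place_congr _ _ _ _ h := by rw [(read_congr h).2]

/-- The number of bits used for the approximations on inputs of length `n`: `2 log log n`,
rounded up. -/
def approxBits (n : ℕ) : ℕ := ⌈2 * Real.logb 2 (Real.logb 2 n)⌉₊

end

end BinCovering

namespace BinCovering

/-! ### Writing the tape -/

/-! Let `N` be the number of 2-items, and let an optimal packing have `m` covered bins with exactly
one 2-item and `k` with none; then `2 * opt ≤ N + m + 2 * k`. Packing the two classes separately
covers about `N / 2 + 2 * k / 3` bins. Since `2 / 3 > 135 / 242`, it suffices to gain `G / 2` over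
this, up to rounding, where `G = 135 / 242 * (m + N) - N` (`exists_tape_covered`).

Small items. Call a 2-item large if it is at least `θ`, where `θ` is the `j`-th largest size and `j`
is about `m - 2r`. Of the `m` bins, at most `j` have a 2-item above `θ`, so about `2r` contain small
items of total size at least `1 - θ` (`opt_structure`). This is twice what `r` reserved bins need,
and the factor two pays for the waste: Dual Worst Fit may fill a white bin to nearly twice its
target, and black bins receive the smaller half of the available black items, the other half paying
for them. So every reserved bin gets `1 - θ`, and small items of total size about `k` remain for
separate bins (`exists_small_advice`, `SmallInv.le_load`, `SmallInv.le_active`).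

2-items. A large 2-item now covers a reserved bin alone. If `g` large items are declared good and
every other reserved bin is completed by a second 2-item, `g` 2-items are saved, a gain of `g / 2`.
If `l` items go singly into reserved bins with no completion, the gain is the number of large ones
minus `l / 2` (`covered_ge`).

It remains to see that some case gains `G / 2`. In the critical situation `m = N`, scaled to 121,
one has `r = 27`, `G = 14`, 67 large items and a last subsequence of chunks of length 14, 13, 13. If
each of the first three subsequences has fewer than 14 large items, the chunks have `x + y + z > 25`
of them. Failure of the other cases means `x + y < 14`, `2 * (y + z) - 26 < 14` and `x + 2 * z - 13
< 14`. The first two give `z > 11` and `x > 5`, hence `x + 2 * z > 27`, contradicting the third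
(`chunk_contradiction`). All rounding costs a multiple of `E = m * 2 / 2 ^ b + 1`. -/

theorem natAt_shift {t u : Tape} {k : ℕ} (h : ∀ i, t (k + i) = u i) (start len : ℕ) :
    natAt t (k + start) len = natAt u start len := by
  unfold natAt
  refine Finset.sum_congr rfl fun i _ => ?_
  rw [add_assoc, h]

theorem exists_natAt_eq (u : Tape) (len v : ℕ) (hv : v < 2 ^ len) :
    ∃ t : Tape, natAt t 0 len = v ∧ ∀ i, t (len + i) = u i := by
  induction len generalizing v with
  | zero => exact ⟨u, by simp at hv; simp [natAt, hv], fun i => by simp⟩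
  | succ l ih =>
    obtain ⟨t, h1, h2⟩ := ih (v / 2) (by rw [pow_succ] at hv; omega)
    -- The least significant bit comes first, so the parity of `v` is prepended to the code of `v /
    -- 2`.
    refine ⟨fun i => if i = 0 then decide (v % 2 = 1) else t (i - 1), ?_, fun i => ?_⟩
    · unfold natAt at h1 ⊢
      rw [Finset.sum_range_succ']
      have : ∀ i, (if t i = true then 2 ^ (i + 1) else 0) = 2 * (if t i = true then 2 ^ i else 0) := by
        intro i; split_ifs <;> ring
      simp only [zero_add] at h1
      simp only [zero_add, Nat.add_eq_zero_iff, one_ne_zero, and_false, if_false,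
        Nat.add_sub_cancel, this, ← Finset.mul_sum, h1]
      have := Nat.div_add_mod v 2
      rcases Nat.mod_two_eq_zero_or_one v with h | h <;> simp [h] <;> omega
    · have : l + 1 + i - 1 = l + i := by omega
      simp [this, h2]

/-- Consecutive fields of given lengths can be written on a tape. -/
theorem exists_fields (F : List (ℕ × ℕ)) (hF : ∀ x ∈ F, x.2 < 2 ^ x.1) :
    ∃ t : Tape, ∀ k (hk : k < F.length),
      natAt t (((F.take k).map Prod.fst).sum) (F[k].1) = F[k].2 := by
  induction F with
  | nil => exact ⟨fun _ => false, fun k hk => by simp at hk⟩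
  | cons x F ih =>
    obtain ⟨u, hu⟩ := ih fun y hy => hF y (List.mem_cons_of_mem _ hy)
    obtain ⟨t, h1, h2⟩ := exists_natAt_eq u x.1 x.2 (hF x List.mem_cons_self)
    refine ⟨t, fun k hk => ?_⟩
    cases k with
    | zero => simpa using h1
    | succ k =>
      have hk' : k < F.length := by simpa using hk
      simp only [List.take_succ_cons, List.map_cons, List.sum_cons, List.getElem_cons_succ]
      rw [natAt_shift h2, hu k hk']

/-- `v` can be written with `b` significant bits and a `b`-bit exponent. -/
def Representable (b v : ℕ) : Prop := ∃ a < 2 ^ b, ∃ e < 2 ^ b, v = a * 2 ^ e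

theorem Representable.zero (b : ℕ) : Representable b 0 := ⟨0, by positivity, 0, by positivity, by simp⟩

theorem exists_decode_eq (b part variant reserved good chunkL chunkR black blackExtra x y : ℕ)
    (h1 : part < 4) (h2 : variant < 4) (h3 : Representable b reserved)
    (h4 : Representable b good) (h5 : Representable b chunkL) (h6 : Representable b chunkR)
    (h7 : Representable b black) (h8 : Representable b blackExtra) (h9 : x < 2 ^ b)
    (h10 : y < 2 ^ b) :
    ∃ t : Tape, decode b t = ⟨false, part, variant, reserved, good, chunkL, chunkR, black,
      blackExtra, ((x : ℝ) + 1) / 2 ^ b, (y : ℝ) / 2 ^ b, ((y : ℝ) + 1) / 2 ^ b⟩ := by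
  obtain ⟨a3, ha3, e3, he3, rfl⟩ := h3
  obtain ⟨a4, ha4, e4, he4, rfl⟩ := h4
  obtain ⟨a5, ha5, e5, he5, rfl⟩ := h5
  obtain ⟨a6, ha6, e6, he6, rfl⟩ := h6
  obtain ⟨a7, ha7, e7, he7, rfl⟩ := h7
  obtain ⟨a8, ha8, e8, he8, rfl⟩ := h8
  -- The fields follow the order in which `decode` reads them; the leading one-bit zero is the
  -- `plain` flag.
  obtain ⟨t, ht⟩ := exists_fields [(1, 0), (2, part), (2, variant), (b, a3), (b, e3), (b, a4),
    (b, e4), (b, a5), (b, e5), (b, a6), (b, e6), (b, a7), (b, e7), (b, a8), (b, e8), (b, x), (b, y)]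
    (by
      intro z hz
      simp only [List.mem_cons, List.not_mem_nil, or_false] at hz
      rcases hz with rfl | rfl | rfl | rfl | rfl | rfl | rfl | rfl | rfl | rfl | rfl | rfl | rfl |
        rfl | rfl | rfl | rfl <;> first | assumption | norm_num)
  refine ⟨t, ?_⟩
  have q0 := ht 0 (by simp)
  have q1 := ht 1 (by simp)
  have q2 := ht 2 (by simp)
  have q3 := ht 3 (by simp)
  have q4 := ht 4 (by simp)
  have q5 := ht 5 (by simp)
  have q6 := ht 6 (by simp)
  have q7 := ht 7 (by simp)
  have q8 := ht 8 (by simp)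
  have q9 := ht 9 (by simp)
  have q10 := ht 10 (by simp)
  have q11 := ht 11 (by simp)
  have q12 := ht 12 (by simp)
  have q13 := ht 13 (by simp)
  have q14 := ht 14 (by simp)
  have q15 := ht 15 (by simp)
  have q16 := ht 16 (by simp)
  simp only [List.take_succ_cons, List.take_zero, List.map_cons, List.map_nil, List.sum_cons,
    List.sum_nil, List.getElem_cons_succ, List.getElem_cons_zero, add_zero] at q0 q1 q2 q3 q4 q5 q6 q7 q8 q9 q10 q11 q12 q13 q14 q15 q16
  have hp : t 0 = false := by
    simpa [natAt] using q0
  have mv : ∀ {s s' l v : ℕ}, natAt t s l = v → s' = s → natAt t s' l = v :=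
    fun h e => e ▸ h
  have ap : ∀ {s a e : ℕ}, natAt t s b = a → natAt t (s + b) b = e → approxAt b t s = a * 2 ^ e :=
    fun h1 h2 => by rw [approxAt, h1, h2]
  have r3 : approxAt b t 5 = a3 * 2 ^ e3 := ap (mv q3 (by ring)) (mv q4 (by ring))
  have r4 : approxAt b t (5 + 2 * b) = a4 * 2 ^ e4 := ap (mv q5 (by ring)) (mv q6 (by ring))
  have r5 : approxAt b t (5 + 4 * b) = a5 * 2 ^ e5 := ap (mv q7 (by ring)) (mv q8 (by ring))
  have r6 : approxAt b t (5 + 6 * b) = a6 * 2 ^ e6 := ap (mv q9 (by ring)) (mv q10 (by ring))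
  have r7 : approxAt b t (5 + 8 * b) = a7 * 2 ^ e7 := ap (mv q11 (by ring)) (mv q12 (by ring))
  have r8 : approxAt b t (5 + 10 * b) = a8 * 2 ^ e8 := ap (mv q13 (by ring)) (mv q14 (by ring))
  have r9 : natAt t (5 + 12 * b) b = x := mv q15 (by ring)
  have r10 : natAt t (5 + 13 * b) b = y := mv q16 (by ring)
  unfold decode
  rw [hp, q1, r3, r4, r5, r6, r7, r8, r9, r10, show natAt t 3 2 = variant from mv q2 (by ring)]

theorem width_selfDelimited (b : ℕ) (t : Tape) : width (selfDelimited b t) = b := by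
  have hb : selfDelimited b t b = false := by simp [selfDelimited]
  refine le_antisymm (Nat.sInf_le hb) ?_
  refine le_csInf ⟨b, hb⟩ fun i hi => ?_
  by_contra! h
  change selfDelimited b t i = false at hi
  rw [selfDelimited, if_pos h] at hi
  exact Bool.noConfusion hi

theorem readAdvice_selfDelimited (b : ℕ) (t : Tape) :
    readAdvice (selfDelimited b t) = decode b t := by
  unfold readAdvice
  rw [width_selfDelimited]
  congr 1
  funext i
  have : b + 1 + i - (b + 1) = i := by omega
  have h1 : ¬ b + 1 + i < b := by omega
  have h2 : b + 1 + i ≠ b := by omega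
  simp [selfDelimited, this, h1, h2]

theorem readLength_selfDelimited (b : ℕ) (t : Tape) :
    readLength (selfDelimited b t) = ((15 * b + 6 : ℕ) : ℕ∞) := by
  have h : ∃ i, selfDelimited b t i = false := ⟨b, by simp [selfDelimited]⟩
  rw [readLength, if_pos h, width_selfDelimited]
  unfold adviceLength
  congr 1
  ring

/-! ### Approximate integers -/

/-- Rounding down to `b` significant bits. -/
theorem exists_representable {b v : ℕ} (hb : 1 ≤ b) (hv : v < 2 ^ (2 ^ b)) :
    ∃ w, Representable b w ∧ w ≤ v ∧ (v : ℝ) ≤ w + v * (2 / 2 ^ b) := by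
  by_cases h : v < 2 ^ b
  · refine ⟨v, ⟨v, h, 0, by positivity, by simp⟩, le_rfl, ?_⟩
    have : (0 : ℝ) ≤ v * (2 / 2 ^ b) := by positivity
    linarith
  · push Not at h
    have hv0 : v ≠ 0 := by
      have : 0 < 2 ^ b := by positivity
      omega
    have hl : b ≤ Nat.log 2 v := Nat.le_log_of_pow_le one_lt_two h
    -- Exactly the `b` leading bits survive, and the part cut off is below `2 ^ e`, which is at most
    -- `v * 2 / 2 ^ b`.
    set e := Nat.log 2 v + 1 - b with he
    have hlog : Nat.log 2 v < 2 ^ b := Nat.log_lt_of_lt_pow hv0 hv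
    have hlt : v < 2 ^ (Nat.log 2 v + 1) := Nat.lt_pow_succ_log_self one_lt_two v
    have hle : 2 ^ Nat.log 2 v ≤ v := Nat.pow_log_le_self 2 hv0
    refine ⟨v / 2 ^ e * 2 ^ e, ⟨v / 2 ^ e, ?_, e, by omega, rfl⟩, Nat.div_mul_le_self _ _, ?_⟩
    · rw [Nat.div_lt_iff_lt_mul (by positivity), ← pow_add]
      rwa [show b + e = Nat.log 2 v + 1 by omega]
    · have h1 : v < v / 2 ^ e * 2 ^ e + 2 ^ e := by
        have := Nat.div_add_mod v (2 ^ e)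
        have h2 := Nat.mod_lt v (show 2 ^ e > 0 by positivity)
        rw [mul_comm] at this
        omega
      have h2 : (2 : ℝ) ^ e ≤ v * (2 / 2 ^ b) := by
        have : (2 : ℝ) ^ e * 2 ^ b = 2 ^ Nat.log 2 v * 2 := by
          rw [← pow_add, ← pow_succ]; congr 1; omega
        have h3 : (2 : ℝ) ^ Nat.log 2 v ≤ v := by exact_mod_cast hle
        rw [← mul_div_assoc, le_div_iff₀ (by positivity), this]
        linarith
      have h3 : (v : ℝ) ≤ (v / 2 ^ e * 2 ^ e : ℕ) + 2 ^ e := by exact_mod_cast h1.le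
      linarith

/-! ### Weights accumulated in a bin -/

open Classical in
/-- Total weight `w` of the items of `h` that the strategy puts into bin `j`. -/
noncomputable def weightIn (p : Advice) (w : ℝ → ℝ) (h : List ℝ) (j : Bin) : ℝ :=
  ∑ i ∈ Finset.range h.length,
    if (step p (stateAfter p (h.take i)) (h.getD i 0)).1 = j then w (h.getD i 0) else 0

@[simp] theorem weightIn_nil (p : Advice) (w : ℝ → ℝ) (j : Bin) : weightIn p w [] j = 0 := by
  simp [weightIn]

open Classical in
theorem weightIn_append (p : Advice) (w : ℝ → ℝ) (h : List ℝ) (v : ℝ) (j : Bin) :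
    weightIn p w (h ++ [v]) j =
      weightIn p w h j + if (step p (stateAfter p h) v).1 = j then w v else 0 := by
  unfold weightIn
  rw [List.length_append, List.length_singleton, Finset.sum_range_succ]
  congr 1
  · refine Finset.sum_congr rfl fun i hi => ?_
    have hi := Finset.mem_range.1 hi
    rw [List.take_append_of_le_length hi.le, List.getD_append _ _ _ _ hi]
  · simp

theorem stateAfter_append (p : Advice) (h : List ℝ) (v : ℝ) :
    stateAfter p (h ++ [v]) = (step p (stateAfter p h) v).2 := by
  simp [stateAfter]

theorem weightIn_le_append {p : Advice} {w : ℝ → ℝ} (h : List ℝ) {v : ℝ} (hv : 0 ≤ w v)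
    (j : Bin) : weightIn p w h j ≤ weightIn p w (h ++ [v]) j := by
  rw [weightIn_append]
  split_ifs <;> linarith

theorem weightIn_append_of_eq {p : Advice} {w : ℝ → ℝ} {h : List ℝ} {v : ℝ} {j : Bin}
    (hj : (step p (stateAfter p h) v).1 = j) :
    weightIn p w (h ++ [v]) j = weightIn p w h j + w v := by
  rw [weightIn_append, if_pos hj]

theorem weightIn_append_of_zero {p : Advice} {w : ℝ → ℝ} {h : List ℝ} {v : ℝ} {j : Bin}
    (hv : w v = 0) : weightIn p w (h ++ [v]) j = weightIn p w h j := by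
  rw [weightIn_append, hv, ite_self, add_zero]

theorem weightIn_add (p : Advice) (w w' : ℝ → ℝ) (h : List ℝ) (j : Bin) :
    weightIn p (fun v => w v + w' v) h j = weightIn p w h j + weightIn p w' h j := by
  unfold weightIn
  rw [← Finset.sum_add_distrib]
  refine Finset.sum_congr rfl fun i _ => ?_
  split_ifs <;> simp

/-- Size of a small item, `0` for the others. -/
noncomputable def smallPart (v : ℝ) : ℝ := if v < 1 / 2 then v else 0

/-- Size of a 2-item, `0` for the others. -/
noncomputable def twoPart (v : ℝ) : ℝ := if v < 1 / 2 then 0 else v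

/-- Since each item contributes to only one of the two parts, the small items and the 2-items can be
followed by separate invariants that are added only at the end. -/
theorem weightIn_id (p : Advice) (h : List ℝ) (j : Bin) :
    weightIn p id h j = weightIn p smallPart h j + weightIn p twoPart h j := by
  rw [← weightIn_add]
  congr 1
  funext v
  unfold smallPart twoPart
  split_ifs <;> simp

theorem smallPart_nonneg {v : ℝ} (hv : 0 < v) : 0 ≤ smallPart v := by
  unfold smallPart; split_ifs <;> linarith

theorem twoPart_nonneg {v : ℝ} (hv : 0 < v) : 0 ≤ twoPart v := by
  unfold twoPart; split_ifs <;> linarith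

theorem weightIn_nonneg {p : Advice} {w : ℝ → ℝ} {h : List ℝ} (hw : ∀ v ∈ h, 0 ≤ w v) (j : Bin) :
    0 ≤ weightIn p w h j := by
  refine Finset.sum_nonneg fun i hi => ?_
  have hi := Finset.mem_range.1 hi
  split_ifs
  · rw [List.getD_eq_getElem _ _ hi]
    exact hw _ (List.getElem_mem hi)
  · exact le_rfl

theorem load_placement (t : Tape) (σ : List ℝ) (j : Bin) :
    load σ (modifiedDualHarmonic.placement t σ) j = weightIn (readAdvice t) id σ j := by
  unfold load weightIn
  rw [Finset.sum_range]
  refine Finset.sum_congr rfl fun i _ => ?_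
  rw [List.getD_eq_getElem _ _ i.2]
  rfl

theorem card_le_covered (t : Tape) (σ : List ℝ) (S : Finset Bin)
    (hS : ∀ j ∈ S, 1 ≤ weightIn (readAdvice t) id σ j) :
    S.card ≤ modifiedDualHarmonic.covered t σ := by
  classical
  unfold AdviceStrategy.covered numCovered
  refine Finset.card_le_card fun j hj => ?_
  have h1 := hS j hj
  rw [← load_placement] at h1
  rw [Finset.mem_filter]
  refine ⟨?_, h1⟩
  by_contra hne
  have : load σ (modifiedDualHarmonic.placement t σ) j = 0 := by
    refine Finset.sum_eq_zero fun i _ => ?_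
    rw [if_neg]
    intro h
    exact hne (Finset.mem_image.2 ⟨i, Finset.mem_univ _, h⟩)
  linarith

/-! ### Dual Next Fit -/

theorem DNF.insert_of_le {s : DNF} {v : ℝ} (h : 1 ≤ s.content + v) :
    s.insert v = ⟨s.active + 1, 0⟩ := if_pos h

theorem DNF.insert_of_lt {s : DNF} {v : ℝ} (h : s.content + v < 1) :
    s.insert v = ⟨s.active, s.content + v⟩ := if_neg (not_le.2 h)

/-! ### Small items -/

/-- The white reserved bins. -/
def Advice.whites (p : Advice) : Finset ℕ := Finset.Ico p.numBlack p.reserved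

theorem placeWhite_cases (p : Advice) (s : State) (v : ℝ) :
    (placeWhite p s v = placeSmallSeparate s v ∧ ∀ i ∈ p.whites, p.dUp ≤ s.white i) ∨
    ∃ i ∈ p.whites, (∀ k ∈ p.whites, s.white i ≤ s.white k) ∧ s.white i < p.dUp ∧
      placeWhite p s v =
        (.reserved i, { s with white := Function.update s.white i (s.white i + v) }) := by
  have hmem : ∀ i, i ∈ (List.range p.reserved).filter (fun i => p.numBlack ≤ i) ↔
      i ∈ p.whites := by
    intro i
    simp [Advice.whites, and_comm]
  unfold placeWhite
  rcases h : ((List.range p.reserved).filter fun i => p.numBlack ≤ i).argmin s.white with _ | i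
  · left
    refine ⟨rfl, fun i hi => ?_⟩
    rw [List.argmin_eq_none] at h
    rw [← hmem, h] at hi
    simp at hi
  · have h1 := (hmem i).1 (List.argmin_mem h)
    have h2 : ∀ k ∈ p.whites, s.white i ≤ s.white k := fun k hk =>
      List.le_of_mem_argmin ((hmem k).2 hk) h
    by_cases hd : s.white i < p.dUp
    · right
      refine ⟨i, h1, h2, hd, ?_⟩
      simp [hd]
    · left
      refine ⟨by simp [hd], fun k hk => (not_lt.1 hd).trans (h2 k hk)⟩

/-- Indicator of the black items that may go to black reserved bins. -/
noncomputable def blackWeight (p : Advice) (v : ℝ) : ℕ :=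
  if v < 1 / 2 ∧ p.dUp ≤ v ∧ v ≤ p.sUp then 1 else 0

/-- Size of a white item, truncated at `d`. -/
noncomputable def truncWeight (p : Advice) (d v : ℝ) : ℝ :=
  if v < 1 / 2 ∧ v < p.dUp then min v d else 0

/-- What is known about the packing of the small items among `h`. -/
structure SmallInv (p : Advice) (d : ℝ) (h : List ℝ) (s : State) : Prop where
  used_le : s.blackUsed ≤ p.numBlack
  extra_le : s.extraUsed ≤ s.blackUsed
  black_load : ∀ i < s.blackUsed, p.dUp ≤ weightIn p smallPart h (.reserved i)
  black_count : s.blackUsed = p.numBlack ∨ (h.map (blackWeight p)).sum ≤ s.blackUsed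
  white_load : ∀ i ∈ p.whites, s.white i ≤ weightIn p smallPart h (.reserved i)
  white_nonneg : ∀ i ∈ p.whites, 0 ≤ s.white i
  white_lt : ∀ i ∈ p.whites, s.white i < 2 * p.dUp
  sep_load : ∀ i < s.smallBins.active, 1 ≤ weightIn p smallPart h (.small i)
  content_le : s.smallBins.content ≤ weightIn p smallPart h (.small s.smallBins.active)
  content_nonneg : 0 ≤ s.smallBins.content
  content_lt : s.smallBins.content < 1
  -- The factor `3 / 2`: a small item that covers a separate bin is below `1 / 2` and arrives when
  -- the content is below 1.
  volume : (h.map smallPart).sum ≤ 3 / 2 * s.smallBins.active + s.smallBins.content +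
    ∑ i ∈ p.whites, s.white i + s.blackUsed * p.sUp
  -- As long as one white bin is below `d`, every white item has gone to a white bin that was below
  -- `d`. Cutting items at `d` and bins at `2 * d` then loses nothing, which is the source of the
  -- factor two.
  trunc : ∀ i ∈ p.whites, s.white i < d →
    (h.map (truncWeight p d)).sum ≤ ∑ i ∈ p.whites, min (s.white i) (2 * d)

variable {p : Advice} {d : ℝ} {h : List ℝ} {v : ℝ}

theorem SmallInv.start (hd : 0 < p.dUp) : SmallInv p d [] State.start := by
  constructor <;> simp [State.start, hd]
  intro i hi h
  have : 0 ≤ min 0 (2 * d) := le_min le_rfl (by linarith)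
  positivity

/-- A 2-item does not change what is known about the small items. -/
theorem SmallInv.append_two (inv : SmallInv p d h (stateAfter p h)) (hv : ¬ v < 1 / 2)
    {s' : State} (h1 : s'.blackUsed = (stateAfter p h).blackUsed)
    (h2 : s'.extraUsed = (stateAfter p h).extraUsed) (h3 : s'.white = (stateAfter p h).white)
    (h4 : s'.smallBins = (stateAfter p h).smallBins) : SmallInv p d (h ++ [v]) s' := by
  have w0 : smallPart v = 0 := if_neg hv
  have b0 : blackWeight p v = 0 := if_neg fun h => hv h.1
  have t0 : truncWeight p d v = 0 := if_neg fun h => hv h.1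
  have hw : ∀ j, weightIn p smallPart (h ++ [v]) j = weightIn p smallPart h j :=
    fun j => weightIn_append_of_zero w0
  constructor <;> simp only [h1, h2, h3, h4, hw, List.map_append, List.sum_append, List.map_cons,
    List.map_nil, List.sum_cons, List.sum_nil, w0, b0, t0, add_zero]
  exacts [inv.used_le, inv.extra_le, inv.black_load, inv.black_count, inv.white_load,
    inv.white_nonneg, inv.white_lt, inv.sep_load, inv.content_le, inv.content_nonneg,
    inv.content_lt, inv.volume, inv.trunc]

/-- Only the counts of black and of truncated white items could suffer from a small item sent
elsewhere. The alternatives `hb` and `ht` say that the reserved bins concerned are already served or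
that the item does not count. -/
theorem SmallInv.append_separate (inv : SmallInv p d h (stateAfter p h)) (hh : IsInput h)
    (h0 : 0 < v) (hv : v < 1 / 2) (hstep : step p (stateAfter p h) v = placeSmallSeparate (stateAfter p h) v)
    (hb : (stateAfter p h).blackUsed = p.numBlack ∨ blackWeight p v = 0)
    (ht : (∀ i ∈ p.whites, d ≤ (stateAfter p h).white i) ∨ truncWeight p d v = 0) :
    SmallInv p d (h ++ [v]) (stateAfter p (h ++ [v])) := by
  have w0 : smallPart v = v := if_pos hv
  have hmono : ∀ j, weightIn p smallPart h j ≤ weightIn p smallPart (h ++ [v]) j :=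
    weightIn_le_append h (smallPart_nonneg h0)
  rw [stateAfter_append, hstep]
  set s := stateAfter p h with hs
  have hnew : weightIn p smallPart (h ++ [v]) (.small s.smallBins.active) =
      weightIn p smallPart h (.small s.smallBins.active) + v := by
    rw [weightIn_append_of_eq (by rw [← hs, hstep]; rfl), w0]
  have c1 := inv.content_le
  have c2 := inv.content_nonneg
  have c3 := inv.content_lt
  have c4 := inv.volume
  refine ⟨inv.used_le, inv.extra_le, fun i hi => (inv.black_load i hi).trans (hmono _), ?_,
    fun i hi => (inv.white_load i hi).trans (hmono _), inv.white_nonneg, inv.white_lt, ?_, ?_, ?_,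
    ?_, ?_, ?_⟩
  · rcases hb with hb | hb
    · exact Or.inl hb
    · simpa [placeSmallSeparate, hb] using inv.black_count
  all_goals rcases le_or_gt 1 (s.smallBins.content + v) with hc | hc
  all_goals simp only [placeSmallSeparate, DNF.insert_of_le, DNF.insert_of_lt, hc, List.map_append,
    List.map_cons, List.map_nil, List.sum_append, List.sum_cons, List.sum_nil, w0, add_zero]
  · intro i hi
    rcases Nat.lt_succ_iff_lt_or_eq.1 hi with hi | rfl
    · exact (inv.sep_load i hi).trans (hmono _)
    · rw [hnew]; linarith
  · intro i hi
    exact (inv.sep_load i hi).trans (hmono _)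
  · exact (weightIn_nonneg (fun x hx => smallPart_nonneg (hh x hx).1) _).trans (hmono _)
  · rw [hnew]; linarith
  · exact le_rfl
  · linarith
  · norm_num
  · push_cast; linarith
  · linarith
  · intro i hi hw
    rcases ht with ht | ht
    · exact absurd hw (not_lt.2 (ht i hi))
    · rw [ht, add_zero]; exact inv.trunc i hi hw
  · intro i hi hw
    rcases ht with ht | ht
    · exact absurd hw (not_lt.2 (ht i hi))
    · rw [ht, add_zero]; exact inv.trunc i hi hw

theorem SmallInv.append_black (inv : SmallInv p d h (stateAfter p h)) (hh : IsInput h)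
    (h0 : 0 < v) (hv : v < 1 / 2) (hd : p.dUp ≤ v) (hs : v ≤ p.sUp)
    (hlt : (stateAfter p h).blackUsed < p.numBlack) {e : ℕ}
    (he : e ≤ (stateAfter p h).extraUsed + 1)
    (hstep : step p (stateAfter p h) v = (.reserved (stateAfter p h).blackUsed,
      { stateAfter p h with
        blackUsed := (stateAfter p h).blackUsed + 1
        extraUsed := e })) :
    SmallInv p d (h ++ [v]) (stateAfter p (h ++ [v])) := by
  have w0 : smallPart v = v := if_pos hv
  have hmono : ∀ j, weightIn p smallPart h j ≤ weightIn p smallPart (h ++ [v]) j :=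
    weightIn_le_append h (smallPart_nonneg h0)
  have t0 : truncWeight p d v = 0 := if_neg fun h => absurd h.2 (not_lt.2 hd)
  have b0 : blackWeight p v = 1 := if_pos ⟨hv, hd, hs⟩
  rw [stateAfter_append, hstep]
  set s := stateAfter p h with hs'
  have hnew : weightIn p smallPart h (.reserved s.blackUsed) + v =
      weightIn p smallPart (h ++ [v]) (.reserved s.blackUsed) := by
    rw [weightIn_append_of_eq (by rw [← hs', hstep]), w0]
  have c4 := inv.volume
  have c5 := inv.extra_le
  refine ⟨hlt, ?_, ?_, ?_, fun i hi => (inv.white_load i hi).trans (hmono _), inv.white_nonneg,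
    inv.white_lt, fun i hi => (inv.sep_load i hi).trans (hmono _), inv.content_le.trans (hmono _),
    inv.content_nonneg, inv.content_lt, ?_, ?_⟩
  · change e ≤ s.blackUsed + 1
    omega
  · intro i hi
    rcases Nat.lt_succ_iff_lt_or_eq.1 hi with hi | rfl
    · exact (inv.black_load i hi).trans (hmono _)
    · have := weightIn_nonneg (p := p) (w := smallPart)
        (fun x hx => smallPart_nonneg (hh x hx).1) (.reserved s.blackUsed)
      rw [← hnew]; linarith
  · right
    have := inv.black_count
    simp only [List.map_append, List.sum_append, List.map_cons, List.map_nil, List.sum_cons,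
      List.sum_nil, b0]
    omega
  · simp only [List.map_append, List.sum_append, List.map_cons, List.map_nil, List.sum_cons,
      List.sum_nil, w0]
    push_cast
    linarith
  · intro i hi hw
    simpa [t0] using inv.trunc i hi hw

theorem SmallInv.append_white (inv : SmallInv p d h (stateAfter p h)) (h0 : 0 < v)
    (hv : v < 1 / 2) (hd : v < p.dUp) {i : ℕ} (hi : i ∈ p.whites)
    (hmin : ∀ k ∈ p.whites, (stateAfter p h).white i ≤ (stateAfter p h).white k)
    (hlt : (stateAfter p h).white i < p.dUp)
    (hstep : step p (stateAfter p h) v = (.reserved i,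
      { stateAfter p h with
        white := Function.update (stateAfter p h).white i ((stateAfter p h).white i + v) })) :
    SmallInv p d (h ++ [v]) (stateAfter p (h ++ [v])) := by
  have w0 : smallPart v = v := if_pos hv
  have hmono : ∀ j, weightIn p smallPart h j ≤ weightIn p smallPart (h ++ [v]) j :=
    weightIn_le_append h (smallPart_nonneg h0)
  have t0 : truncWeight p d v = min v d := if_pos ⟨hv, hd⟩
  have b0 : blackWeight p v = 0 := if_neg fun h => absurd h.2.1 (not_le.2 hd)
  rw [stateAfter_append, hstep]
  set s := stateAfter p h with hs'
  have hnew : weightIn p smallPart h (.reserved i) + v =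
      weightIn p smallPart (h ++ [v]) (.reserved i) := by
    rw [weightIn_append_of_eq (by rw [← hs', hstep]), w0]
  have hcases : ∀ k, Function.update s.white i (s.white i + v) k =
      s.white k + if k = i then v else 0 := by
    intro k
    by_cases hk : k = i
    · subst hk; simp
    · simp [hk]
  have c4 := inv.volume
  refine ⟨inv.used_le, inv.extra_le, fun i hi => (inv.black_load i hi).trans (hmono _), ?_,
    ?_, ?_, ?_, fun i hi => (inv.sep_load i hi).trans (hmono _), inv.content_le.trans (hmono _),
    inv.content_nonneg, inv.content_lt, ?_, ?_⟩
  · simpa [b0] using inv.black_count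
  · intro k hk
    have h1 := inv.white_load k hk
    simp only [hcases]
    split_ifs with hki
    · subst hki; rw [← hnew]; linarith
    · rw [add_zero]; exact h1.trans (hmono _)
  · intro k hk
    have h1 := inv.white_nonneg k hk
    simp only [hcases]
    split_ifs <;> linarith
  · intro k hk
    have h1 := inv.white_lt k hk
    simp only [hcases]
    split_ifs with hki
    · subst hki; linarith
    · linarith
  · simp only [hcases, Finset.sum_add_distrib, Finset.sum_ite_eq', if_pos hi, List.map_append,
      List.sum_append, List.map_cons, List.map_nil, List.sum_cons, List.sum_nil, w0]
    linarith
  · intro k hk hw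
    simp only [hcases] at hw ⊢
    -- The receiving bin was a least loaded one, so it was below `d` itself; its load cut at `2 * d`
    -- therefore grows by at least `min v d`.
    have hik : s.white i < d := by
      have := hmin k hk
      split_ifs at hw <;> linarith
    have h1 := inv.trunc i hi hik
    have h2 : ∑ k ∈ p.whites, (min (s.white k) (2 * d) + if k = i then min v d else 0) ≤
        ∑ k ∈ p.whites, min (s.white k + if k = i then v else 0) (2 * d) := by
      refine Finset.sum_le_sum fun k hk => ?_
      by_cases hki : k = i
      · subst hki
        simp only [if_true]
        refine le_min ?_ ?_
        · exact add_le_add (min_le_left _ _) (min_le_left _ _)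
        · have e1 := min_le_left (s.white k) (2 * d)
          have e2 := min_le_right v d
          linarith
      · simp [hki]
    rw [Finset.sum_add_distrib, Finset.sum_ite_eq', if_pos hi] at h2
    simp only [List.map_append, List.sum_append, List.map_cons, List.map_nil, List.sum_cons,
      List.sum_nil, t0, add_zero]
    linarith

theorem placeTwo_small_part (p : Advice) (s : State) (v : ℝ) :
    (placeTwo p s v).2.blackUsed = s.blackUsed ∧ (placeTwo p s v).2.extraUsed = s.extraUsed ∧
    (placeTwo p s v).2.white = s.white ∧ (placeTwo p s v).2.smallBins = s.smallBins := by
  unfold placeTwo placeTwoSeparate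
  split_ifs <;> simp

theorem smallInv_stateAfter (hp : p.plain = false) (hd0 : 0 < p.dUp) (hd : d ≤ p.dUp)
    (hs : p.sDown ≤ p.sUp) (hextra : p.numBlack ≤ p.blackExtra) (h : List ℝ) (hh : IsInput h) :
    SmallInv p d h (stateAfter p h) := by
  induction h using List.reverseRecOn with
  | nil => exact SmallInv.start hd0
  | append_singleton h v ih =>
    have hh' : IsInput h := fun x hx => hh x (List.mem_append_left _ hx)
    have inv := ih hh'
    have h0 := (hh v (by simp)).1
    by_cases hv : v < 1 / 2
    · have hstep : step p (stateAfter p h) v =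
          if p.dUp ≤ v then placeBlack p (stateAfter p h) v
          else placeWhite p (stateAfter p h) v := by
        rw [step, if_pos hv, placeSmall, if_neg (by simp [hp])]
      by_cases hb : p.dUp ≤ v
      · rw [if_pos hb] at hstep
        have t0 : truncWeight p d v = 0 := if_neg fun h => absurd h.2 (not_lt.2 hb)
        unfold placeBlack at hstep
        split_ifs at hstep with h1 h2
        · exact inv.append_black hh' h0 hv hb (h1.2.trans hs) h1.1 (Nat.le_succ _) hstep
        · exact inv.append_black hh' h0 hv hb h2.2.1 h2.1 le_rfl hstep
        · refine inv.append_separate hh' h0 hv hstep ?_ (Or.inr t0)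
          -- A black item of size at most `sUp` cannot be refused while a black bin is free:
          -- `extraUsed ≤ blackUsed < numBlack ≤ blackExtra`, so the quota is not exhausted.
          by_contra! hcon
          have h3 : (stateAfter p h).blackUsed < p.numBlack :=
            lt_of_le_of_ne inv.used_le hcon.1
          have h4 : v ≤ p.sUp := by
            by_contra h5
            exact hcon.2 (if_neg fun h6 => h5 h6.2.2)
          exact h2 ⟨h3, h4, lt_of_le_of_lt inv.extra_le (h3.trans_le hextra)⟩
      · rw [if_neg hb] at hstep
        have b0 : blackWeight p v = 0 := if_neg fun h => hb h.2.1
        rcases placeWhite_cases p (stateAfter p h) v with ⟨h1, h2⟩ | ⟨i, hi, h1, h2, h3⟩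
        · exact inv.append_separate hh' h0 hv (hstep.trans h1) (Or.inr b0)
            (Or.inl fun i hi => hd.trans (h2 i hi))
        · exact inv.append_white h0 hv (not_le.1 hb) hi h1 h2 (hstep.trans h3)
    · have hstep : step p (stateAfter p h) v = placeTwo p (stateAfter p h) v := by
        rw [step, if_neg hv]
      rw [stateAfter_append, hstep]
      obtain ⟨h1, h2, h3, h4⟩ := placeTwo_small_part p (stateAfter p h) v
      exact inv.append_two hv h1 h2 h3 h4

theorem Advice.card_whites (p : Advice) : (p.whites.card : ℝ) = p.reserved - p.numBlack := by
  have : p.numBlack ≤ p.reserved := min_le_right _ _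
  simp [Advice.whites, Nat.cast_sub this]

/-- If there are enough black and white items, every reserved bin gets small items of total size
at least `d`. -/
theorem SmallInv.le_load {s : State} (inv : SmallInv p d h s) (hd : d ≤ p.dUp)
    (hb : p.numBlack ≤ (h.map (blackWeight p)).sum)
    (hw : 2 * ((p.reserved : ℝ) - p.numBlack) * d ≤ (h.map (truncWeight p d)).sum)
    {i : ℕ} (hi : i < p.reserved) : d ≤ weightIn p smallPart h (.reserved i) := by
  by_cases hib : i < p.numBlack
  · have hused : s.blackUsed = p.numBlack := by
      have := inv.used_le
      rcases inv.black_count with h | h <;> omega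
    exact hd.trans (inv.black_load i (hused ▸ hib))
  · have hiw : i ∈ p.whites := Finset.mem_Ico.2 ⟨not_lt.1 hib, hi⟩
    refine le_trans ?_ (inv.white_load i hiw)
    -- With one white bin below `d`, the whole truncated supply would sit in white bins whose loads,
    -- cut at `2 * d`, sum to less than `2 * d` per bin; this contradicts `hw`.
    by_contra! hlt
    have h1 := inv.trunc i hiw hlt
    have h0 := inv.white_nonneg i hiw
    have h2 : ∑ i ∈ p.whites, min (s.white i) (2 * d) < ∑ i ∈ p.whites, 2 * d :=
      Finset.sum_lt_sum (fun i _ => min_le_right _ _)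
        ⟨i, hiw, (min_le_left _ _).trans_lt (by linarith)⟩
    rw [Finset.sum_const, nsmul_eq_mul, p.card_whites] at h2
    linarith

/-- The number of separate bins covered by small items. -/
theorem SmallInv.le_active {s : State} (inv : SmallInv p d h s) (hs : 0 ≤ p.sUp) :
    2 / 3 * ((h.map smallPart).sum - 2 * (p.reserved - p.numBlack) * p.dUp -
      p.numBlack * p.sUp - 1) ≤ (s.smallBins.active : ℝ) := by
  have h1 := inv.volume
  have h2 := inv.content_lt
  have h3 : ∑ i ∈ p.whites, s.white i ≤ ∑ i ∈ p.whites, 2 * p.dUp :=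
    Finset.sum_le_sum fun i hi => (inv.white_lt i hi).le
  rw [Finset.sum_const, nsmul_eq_mul, p.card_whites] at h3
  have h4 : (s.blackUsed : ℝ) * p.sUp ≤ p.numBlack * p.sUp :=
    mul_le_mul_of_nonneg_right (by exact_mod_cast inv.used_le) hs
  linarith

/-! ### 2-items -/

/-- The subsequence of 2-items. -/
noncomputable def twos (h : List ℝ) : List ℝ := h.filter fun v => ¬ v < 1 / 2

/-- What is known about the packing of the 2-items among `h`: the list `F` of those that came first
into their reserved bins, the number `m` of those put into the reserved bins listed in `B`. -/
structure TwoInv (p : Advice) (h : List ℝ) (s : State) (F : List ℝ) (B : List ℕ) (m : ℕ) :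
    Prop where
  seen : s.twoSeen = (twos h).length
  firsts : s.firsts = F
  matched : s.matched = m
  half_le : ∀ x ∈ F, 1 / 2 ≤ x
  first_load : ∀ i < F.length, F.getD i 0 ≤ weightIn p twoPart h (.reserved i)
  matched_load : ∀ q < m, 1 ≤ weightIn p twoPart h (.reserved (B.getD q 0))
  sep_load : ∀ i < s.twoBins.active, 1 ≤ weightIn p twoPart h (.two i)
  content_le : s.twoBins.content ≤ weightIn p twoPart h (.two s.twoBins.active)
  count : (s.twoBins.content = 0 ∧ (twos h).length = F.length + m + 2 * s.twoBins.active) ∨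
    (1 / 2 ≤ s.twoBins.content ∧ s.twoBins.content < 1 ∧
      (twos h).length = F.length + m + 2 * s.twoBins.active + 1)

variable {p : Advice} {h : List ℝ} {v : ℝ} {F : List ℝ} {B : List ℕ} {m : ℕ}

theorem twos_append_of_lt (hv : v < 1 / 2) : twos (h ++ [v]) = twos h := by
  unfold twos
  rw [List.filter_append, List.filter_singleton]
  simp only [hv, not_true_eq_false, decide_false, cond_false, List.append_nil]

theorem twos_append_of_le (hv : ¬ v < 1 / 2) : twos (h ++ [v]) = twos h ++ [v] := by
  unfold twos
  rw [List.filter_append, List.filter_singleton]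
  simp only [hv, not_false_eq_true, decide_true, cond_true]

theorem TwoInv.append_small {s' : State} (inv : TwoInv p h (stateAfter p h) F B m)
    (hv : v < 1 / 2) (h1 : s'.twoSeen = (stateAfter p h).twoSeen)
    (h2 : s'.firsts = (stateAfter p h).firsts) (h3 : s'.matched = (stateAfter p h).matched)
    (h4 : s'.twoBins = (stateAfter p h).twoBins) : TwoInv p (h ++ [v]) s' F B m := by
  have hw : ∀ j, weightIn p twoPart (h ++ [v]) j = weightIn p twoPart h j :=
    fun j => weightIn_append_of_zero (if_pos hv)
  constructor <;> try simp only [h1, h2, h3, h4, hw, twos_append_of_lt hv]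
  exacts [inv.seen, inv.firsts, inv.matched, inv.half_le, inv.first_load, inv.matched_load,
    inv.sep_load, inv.content_le, inv.count]

theorem TwoInv.append_separate (inv : TwoInv p h (stateAfter p h) F B m) (hh : IsInput h)
    (hv1 : v < 1) (hv : ¬ v < 1 / 2)
    (hstep : step p (stateAfter p h) v = placeTwoSeparate (stateAfter p h) v) :
    TwoInv p (h ++ [v]) (stateAfter p (h ++ [v])) F B m := by
  have hv' := not_lt.1 hv
  have w0 : twoPart v = v := if_neg hv
  have hmono : ∀ j, weightIn p twoPart h j ≤ weightIn p twoPart (h ++ [v]) j :=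
    weightIn_le_append h (twoPart_nonneg (by linarith))
  have hpos : ∀ j, 0 ≤ weightIn p twoPart h j :=
    weightIn_nonneg fun x hx => twoPart_nonneg (hh x hx).1
  rw [stateAfter_append, hstep]
  set s := stateAfter p h with hs
  have hnew : weightIn p twoPart h (.two s.twoBins.active) + v =
      weightIn p twoPart (h ++ [v]) (.two s.twoBins.active) := by
    rw [weightIn_append_of_eq (by rw [← hs, hstep]; rfl), w0]
  have c1 := inv.content_le
  have c2 := inv.seen
  have c3 := inv.count
  have hl : (twos (h ++ [v])).length = (twos h).length + 1 := by simp [twos_append_of_le hv]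
  refine ⟨by simp [placeTwoSeparate, hl, c2], inv.firsts, inv.matched, inv.half_le,
    fun i hi => (inv.first_load i hi).trans (hmono _),
    fun i hi => (inv.matched_load i hi).trans (hmono _), ?_, ?_, ?_⟩
  all_goals rcases le_or_gt 1 (s.twoBins.content + v) with hc | hc
  all_goals simp only [placeTwoSeparate, DNF.insert_of_le, DNF.insert_of_lt, hc, hl]
  · intro i hi
    rcases Nat.lt_succ_iff_lt_or_eq.1 hi with hi | rfl
    · exact (inv.sep_load i hi).trans (hmono _)
    · rw [← hnew]; linarith
  · exact fun i hi => (inv.sep_load i hi).trans (hmono _)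
  · exact (hpos _).trans (hmono _)
  · rw [← hnew]; linarith
  · rcases c3 with ⟨c3, c4⟩ | ⟨c3, c4, c5⟩
    · rw [c3] at hc; linarith
    · left; exact ⟨trivial, by omega⟩
  · rcases c3 with ⟨c3, c4⟩ | ⟨c3, c4, c5⟩
    · right; exact ⟨by linarith, by trivial, by omega⟩
    · linarith

theorem TwoInv.append_first (inv : TwoInv p h (stateAfter p h) F B m) (hh : IsInput h)
    (hv : ¬ v < 1 / 2)
    (hstep : step p (stateAfter p h) v = (.reserved (stateAfter p h).firsts.length,
      { stateAfter p h with
        twoSeen := (stateAfter p h).twoSeen + 1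
        firsts := (stateAfter p h).firsts ++ [v] })) :
    TwoInv p (h ++ [v]) (stateAfter p (h ++ [v])) (F ++ [v]) B m := by
  have hv' := not_lt.1 hv
  have w0 : twoPart v = v := if_neg hv
  have hmono : ∀ j, weightIn p twoPart h j ≤ weightIn p twoPart (h ++ [v]) j :=
    weightIn_le_append h (twoPart_nonneg (by linarith))
  have hpos : ∀ j, 0 ≤ weightIn p twoPart h j :=
    weightIn_nonneg fun x hx => twoPart_nonneg (hh x hx).1
  have hl : (twos (h ++ [v])).length = (twos h).length + 1 := by simp [twos_append_of_le hv]
  rw [stateAfter_append, hstep]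
  set s := stateAfter p h with hs
  have hnew : weightIn p twoPart h (.reserved F.length) + v =
      weightIn p twoPart (h ++ [v]) (.reserved F.length) := by
    rw [weightIn_append_of_eq (by rw [← hs, hstep, inv.firsts]), w0]
  refine ⟨by simp [hl, inv.seen], by simp [inv.firsts], inv.matched, ?_, ?_,
    fun i hi => (inv.matched_load i hi).trans (hmono _),
    fun i hi => (inv.sep_load i hi).trans (hmono _), inv.content_le.trans (hmono _), ?_⟩
  · intro x hx
    rcases List.mem_append.1 hx with hx | hx
    · exact inv.half_le x hx
    · rw [List.mem_singleton.1 hx]; exact hv'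
  · intro i hi
    rw [List.length_append, List.length_singleton] at hi
    rcases Nat.lt_succ_iff_lt_or_eq.1 hi with hi | rfl
    · rw [List.getD_append _ _ _ _ hi]
      exact (inv.first_load i hi).trans (hmono _)
    · rw [← hnew]
      simpa using hpos _
  · have := inv.count
    rw [hl, List.length_append, List.length_singleton]
    rcases this with ⟨c3, c4⟩ | ⟨c3, c4, c5⟩
    · left; exact ⟨c3, by dsimp only; omega⟩
    · right; exact ⟨c3, c4, by dsimp only; omega⟩

theorem TwoInv.append_matched (inv : TwoInv p h (stateAfter p h) F B m)
    (hv : ¬ v < 1 / 2) (hB : B.getD m 0 < F.length)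
    (hstep : step p (stateAfter p h) v = (.reserved (B.getD m 0),
      { stateAfter p h with
        twoSeen := (stateAfter p h).twoSeen + 1
        matched := (stateAfter p h).matched + 1 })) :
    TwoInv p (h ++ [v]) (stateAfter p (h ++ [v])) F B (m + 1) := by
  have hv' := not_lt.1 hv
  have w0 : twoPart v = v := if_neg hv
  have hmono : ∀ j, weightIn p twoPart h j ≤ weightIn p twoPart (h ++ [v]) j :=
    weightIn_le_append h (twoPart_nonneg (by linarith))
  have hl : (twos (h ++ [v])).length = (twos h).length + 1 := by simp [twos_append_of_le hv]
  rw [stateAfter_append, hstep]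
  set s := stateAfter p h with hs
  have hnew : weightIn p twoPart h (.reserved (B.getD m 0)) + v =
      weightIn p twoPart (h ++ [v]) (.reserved (B.getD m 0)) := by
    rw [weightIn_append_of_eq (by rw [← hs, hstep]), w0]
  refine ⟨by simp [hl, inv.seen], inv.firsts, by simp [inv.matched], inv.half_le,
    fun i hi => (inv.first_load i hi).trans (hmono _), ?_,
    fun i hi => (inv.sep_load i hi).trans (hmono _), inv.content_le.trans (hmono _), ?_⟩
  · intro q hq
    rcases Nat.lt_succ_iff_lt_or_eq.1 hq with hq | rfl
    · exact (inv.matched_load q hq).trans (hmono _)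
    · have h1 := inv.first_load _ hB
      have h2 : 1 / 2 ≤ F.getD (B.getD q 0) 0 := by
        rw [List.getD_eq_getElem _ _ hB]
        exact inv.half_le _ (List.getElem_mem _)
      rw [← hnew]
      linarith
  · have := inv.count
    rw [hl]
    rcases this with ⟨c3, c4⟩ | ⟨c3, c4, c5⟩
    · left; exact ⟨c3, by dsimp only; omega⟩
    · right; exact ⟨c3, c4, by dsimp only; omega⟩

/-- The list of bins to be completed changes with each item of the filling phase and becomes final
only at its end. Until then no bin has been completed, so the list can be replaced freely. -/
theorem TwoInv.congr_bins {s : State} (inv : TwoInv p h s F B 0) (B' : List ℕ) :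
    TwoInv p h s F B' 0 :=
  { inv with matched_load := fun q hq => absurd hq (Nat.not_lt_zero q) }

theorem placeSmall_two_part (p : Advice) (s : State) (v : ℝ) :
    (placeSmall p s v).2.twoSeen = s.twoSeen ∧ (placeSmall p s v).2.firsts = s.firsts ∧
    (placeSmall p s v).2.matched = s.matched ∧ (placeSmall p s v).2.twoBins = s.twoBins := by
  unfold placeSmall placeBlack placeWhite placeSmallSeparate
  split_ifs <;> try simp
  split <;> try split_ifs
  all_goals simp

theorem mem_nonGood {g : ℕ} {l : List ℝ} {i : ℕ} :
    i ∈ nonGood g l ↔ i < l.length ∧ g ≤ rank l i := by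
  simp [nonGood]

/-- There are three phases: up to `e` (filling from `a` on), from `e` to `R` (completing the bins
not declared good), and from `R` on (filling the remaining reserved bins). As `resume` may be `⊤`,
it is compared with `R` only at indices below `N`; this permits `R = N` when filling never resumes.
-/
theorem twoInv_stateAfter {a e R N : ℕ} (hp : p.plain = false) (ha : p.fillStart = a)
    (he : p.fillEnd = e) (hR : ∀ x < N, p.resume ≤ (x : ℕ∞) ↔ R ≤ x) (hae : a ≤ e) (heR : e ≤ R)
    (hr : e - a ≤ p.reserved) (h : List ℝ) (hh : IsInput h) (hN : (twos h).length ≤ N) :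
    TwoInv p h (stateAfter p h)
      (((twos h).take e).drop a ++ ((twos h).drop R).take (p.reserved - (e - a)))
      (nonGood p.declared (((twos h).take e).drop a))
      (min (min (twos h).length R - e)
        (nonGood p.declared (((twos h).take e).drop a)).length) := by
  induction h using List.reverseRecOn with
  | nil =>
    constructor <;> simp [State.start, twos, stateAfter]
  | append_singleton h v ih =>
    have hh' : IsInput h := fun x hx => hh x (List.mem_append_left _ hx)
    have hv01 := hh v (by simp)
    by_cases hv : v < 1 / 2
    · rw [twos_append_of_lt hv] at hN ⊢
      have hstep : step p (stateAfter p h) v = placeSmall p (stateAfter p h) v := by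
        rw [step, if_pos hv]
      rw [stateAfter_append, hstep]
      obtain ⟨h1, h2, h3, h4⟩ := placeSmall_two_part p (stateAfter p h) v
      exact (ih hh' hN).append_small hv h1 h2 h3 h4
    · rw [twos_append_of_le hv] at hN ⊢
      rw [List.length_append, List.length_singleton] at hN
      have inv := ih hh' (by omega)
      set u := twos h with hu
      set s := stateAfter p h with hs
      set n := u.length with hn
      have hRn := hR n (by omega)
      have hseen : s.twoSeen = n := inv.seen
      have hstep : step p s v = placeTwo p s v := by rw [step, if_neg hv]
      rw [placeTwo, if_neg (by simp [hp]), ha, he, hseen] at hstep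
      rw [List.length_append, List.length_singleton, ← hn]
      rcases lt_or_ge n e with hne | hne
      · have e1 : min n R - e = 0 := by omega
        have e2 : min (n + 1) R - e = 0 := by omega
        have d1 : u.drop R = [] := List.drop_eq_nil_of_le (by omega)
        have d2 : (u ++ [v]).drop R = [] := List.drop_eq_nil_of_le (by simp; omega)
        have t1 : u.take e = u := List.take_of_length_le (by omega)
        have t2 : (u ++ [v]).take e = u ++ [v] := List.take_of_length_le (by simp; omega)
        rw [e1, Nat.zero_min, d1, t1, List.take_nil, List.append_nil] at inv
        rw [e2, Nat.zero_min, d2, t2, List.take_nil, List.append_nil]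
        have inv := inv.congr_bins (nonGood p.declared (List.drop a (u ++ [v])))
        have hfl : s.firsts.length = n - a := by rw [inv.firsts, List.length_drop]
        rcases lt_or_ge n a with hna | hna
        · rw [if_neg (by rintro ⟨⟨h1, -⟩ | h1, -⟩
                         · omega
                         · have := hRn.1 h1; omega),
            if_neg (by rintro ⟨h1, -⟩; omega)] at hstep
          rw [List.drop_eq_nil_of_le (by omega)] at inv
          have : (u ++ [v]).drop a = [] := List.drop_eq_nil_of_le (by simp; omega)
          rw [this] at inv ⊢
          exact inv.append_separate hh' hv01.2 hv hstep
        · rw [if_pos ⟨Or.inl ⟨hna, hne⟩, by omega⟩] at hstep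
          rw [List.drop_append_of_le_length hna] at inv ⊢
          refine inv.append_first hh' hv ?_
          rw [← hs, hstep, hseen]
      · have t2 : (u ++ [v]).take e = u.take e := List.take_append_of_le_length hne
        have hU1 : ((u.take e).drop a).length = e - a := by
          rw [List.length_drop, List.length_take]; omega
        rw [t2]
        set U1 := (u.take e).drop a with hU1def
        set G := nonGood p.declared U1 with hG
        rcases lt_or_ge n R with hnR | hnR
        · have d1 : u.drop R = [] := List.drop_eq_nil_of_le (by omega)
          have d2 : (u ++ [v]).drop R = [] := List.drop_eq_nil_of_le (by simp; omega)
          rw [d1, List.take_nil, List.append_nil, show min n R = n by omega] at inv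
          rw [d2, List.take_nil, List.append_nil, show min (n + 1) R = n + 1 by omega]
          have hm : s.matched = min (n - e) G.length := inv.matched
          have hF : s.firsts = U1 := inv.firsts
          rw [if_neg (by rintro ⟨⟨-, h1⟩ | h1, -⟩
                         · omega
                         · have := hRn.1 h1; omega), hF, ← hG, hm] at hstep
          by_cases hlt : min (n - e) G.length < G.length
          · rw [if_pos ⟨hne, not_le.1 fun h1 => by have := hRn.1 h1; omega, hlt⟩] at hstep
            have : min (n + 1 - e) G.length = min (n - e) G.length + 1 := by omega
            rw [this]
            refine inv.append_matched hv ?_ ?_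
            · rw [List.getD_eq_getElem _ _ hlt]
              exact (mem_nonGood.1 (List.getElem_mem hlt)).1
            · rw [← hs, hstep]
              simp only [hseen, hm, hF]
          · rw [if_neg (fun h1 => hlt h1.2.2)] at hstep
            have : min (n + 1 - e) G.length = min (n - e) G.length := by omega
            rw [this]
            exact inv.append_separate hh' hv01.2 hv hstep
        · have d2 : (u ++ [v]).drop R = u.drop R ++ [v] := List.drop_append_of_le_length hnR
          rw [show min n R = R by omega] at inv
          rw [d2, show min (n + 1) R = R by omega]
          have hfl : s.firsts.length = (e - a) + min (p.reserved - (e - a)) (n - R) := by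
            rw [inv.firsts, List.length_append, hU1, List.length_take, List.length_drop]
          by_cases hlt : n - R < p.reserved - (e - a)
          · rw [if_pos ⟨Or.inr (hRn.2 hnR), by omega⟩] at hstep
            rw [List.take_of_length_le (by rw [List.length_drop]; omega)] at inv
            rw [List.take_of_length_le (by simp; omega), ← List.append_assoc]
            refine inv.append_first hh' hv ?_
            rw [← hs, hstep, hseen]
          · rw [if_neg (by rintro ⟨-, h1⟩; omega),
              if_neg (by rintro ⟨-, h1, -⟩; exact absurd (hRn.2 hnR) (not_le.2 h1))] at hstep
            rw [List.take_append_of_le_length (by rw [List.length_drop]; omega)]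
            exact inv.append_separate hh' hv01.2 hv hstep

/-! ### Large entries and ranks -/

/-- Number of entries of size at least `θ`. -/
noncomputable def bigCount (θ : ℝ) (l : List ℝ) : ℕ := l.countP fun x => θ ≤ x

theorem bigCount_append (θ : ℝ) (l l' : List ℝ) :
    bigCount θ (l ++ l') = bigCount θ l + bigCount θ l' := List.countP_append

theorem bigCount_le_length (θ : ℝ) (l : List ℝ) : bigCount θ l ≤ l.length := List.countP_le_length

theorem bigCount_eq_card (θ : ℝ) (l : List ℝ) :
    bigCount θ l = ((Finset.range l.length).filter fun i => θ ≤ l.getD i 0).card := by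
  induction l using List.reverseRecOn with
  | nil => simp [bigCount]
  | append_singleton l v ih =>
    rw [bigCount_append, ih, Finset.card_filter, Finset.card_filter, List.length_append,
      List.length_singleton, Finset.sum_range_succ]
    congr 1
    · refine Finset.sum_congr rfl fun i hi => ?_
      rw [List.getD_append _ _ _ _ (Finset.mem_range.1 hi)]
    · simp [bigCount, List.countP_singleton]

theorem rank_lt_rank {l : List ℝ} {i k : ℕ} (hi : i < l.length)
    (h : l.getD k 0 < l.getD i 0 ∨ (l.getD k 0 = l.getD i 0 ∧ i < k)) : rank l i < rank l k := by
  classical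
  unfold rank
  refine Finset.card_lt_card (Finset.ssubset_iff_of_subset ?_ |>.2 ⟨i, ?_, ?_⟩)
  · intro j hj
    simp only [Finset.mem_filter, Finset.mem_range] at hj ⊢
    refine ⟨hj.1, ?_⟩
    rcases h with h | ⟨h, h'⟩ <;> rcases hj.2 with h2 | ⟨h2, h2'⟩
    · exact Or.inl (h.trans h2)
    · exact Or.inl (h2 ▸ h)
    · exact Or.inl (h ▸ h2)
    · exact Or.inr ⟨h.trans h2, h2'.trans h'⟩
  · simp only [Finset.mem_filter, Finset.mem_range]
    exact ⟨hi, h⟩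
  · simp

theorem rank_lt_length {l : List ℝ} {i : ℕ} (hi : i < l.length) : rank l i < l.length := by
  classical
  unfold rank
  calc _ < (Finset.range l.length).card := by
        refine Finset.card_lt_card (Finset.ssubset_iff_of_subset (Finset.filter_subset _ _) |>.2
          ⟨i, Finset.mem_range.2 hi, by simp⟩)
    _ = _ := Finset.card_range _

theorem rank_injOn (l : List ℝ) : Set.InjOn (rank l) (Finset.range l.length) := by
  intro i hi k hk h
  have hi := Finset.mem_range.1 hi
  have hk := Finset.mem_range.1 hk
  by_contra hne
  rcases lt_trichotomy (l.getD k 0) (l.getD i 0) with h1 | h1 | h1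
  · exact absurd h (rank_lt_rank hi (Or.inl h1)).ne
  · rcases lt_or_gt_of_ne hne with h2 | h2
    · exact absurd h (rank_lt_rank hi (Or.inr ⟨h1, h2⟩)).ne
    · exact absurd h (rank_lt_rank hk (Or.inr ⟨h1.symm, h2⟩)).ne'
  · exact absurd h (rank_lt_rank hk (Or.inl h1)).ne'

/-- Positions of the `g` largest entries. -/
noncomputable def goodSet (g : ℕ) (l : List ℝ) : Finset ℕ :=
  (Finset.range l.length).filter fun i => rank l i < g

/-- Ranks are distinct and below the length, so they form a permutation of the positions, and
exactly `g` of them are below `g`. -/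
theorem card_goodSet {g : ℕ} {l : List ℝ} (hg : g ≤ l.length) : (goodSet g l).card = g := by
  have himg : (Finset.range l.length).image (rank l) = Finset.range l.length := by
    refine Finset.eq_of_subset_of_card_le ?_ ?_
    · intro x hx
      obtain ⟨i, hi, rfl⟩ := Finset.mem_image.1 hx
      exact Finset.mem_range.2 (rank_lt_length (Finset.mem_range.1 hi))
    · rw [Finset.card_image_of_injOn (rank_injOn l)]
  have h2 : (goodSet g l).image (rank l) = Finset.range g := by
    ext x
    simp only [goodSet, Finset.mem_image, Finset.mem_filter, Finset.mem_range]
    constructor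
    · rintro ⟨i, ⟨_, h⟩, rfl⟩
      exact h
    · intro hx
      have : x ∈ (Finset.range l.length).image (rank l) := by
        rw [himg]; exact Finset.mem_range.2 (hx.trans_le hg)
      obtain ⟨i, hi, rfl⟩ := Finset.mem_image.1 this
      exact ⟨i, ⟨Finset.mem_range.1 hi, hx⟩, rfl⟩
  have h3 : Set.InjOn (rank l) (goodSet g l) := fun i hi k hk h =>
    rank_injOn l (Finset.mem_coe.2 (Finset.mem_filter.1 (Finset.mem_coe.1 hi)).1)
      (Finset.mem_coe.2 (Finset.mem_filter.1 (Finset.mem_coe.1 hk)).1) h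
  rw [← Finset.card_image_of_injOn h3, h2, Finset.card_range]

theorem nonGood_nodup (g : ℕ) (l : List ℝ) : (nonGood g l).Nodup :=
  List.nodup_range.filter _

theorem length_nonGood {g : ℕ} {l : List ℝ} (hg : g ≤ l.length) :
    (nonGood g l).length = l.length - g := by
  have h1 : (nonGood g l).toFinset = (Finset.range l.length).filter fun i => ¬ rank l i < g := by
    ext i
    simp [mem_nonGood]
  rw [← List.toFinset_card_of_nodup (nonGood_nodup g l), h1]
  have := Finset.card_filter_add_card_filter_not (s := Finset.range l.length)
    (fun i => rank l i < g)
  have h2 := card_goodSet hg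
  rw [goodSet] at h2
  rw [Finset.card_range] at this
  omega

/-- An entry below `θ` is preceded by all entries of size at least `θ`, so its rank is at least
`bigCount θ l ≥ g`. -/
theorem le_of_mem_goodSet {g : ℕ} {l : List ℝ} {θ : ℝ} (hg : g ≤ bigCount θ l) {i : ℕ}
    (hi : i ∈ goodSet g l) : θ ≤ l.getD i 0 := by
  classical
  by_contra! hlt
  have h1 := (Finset.mem_filter.1 hi).2
  have h2 : bigCount θ l ≤ rank l i := by
    rw [bigCount_eq_card]
    unfold rank
    refine Finset.card_le_card fun j hj => ?_
    simp only [Finset.mem_filter] at hj ⊢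
    exact ⟨hj.1, Or.inl (hlt.trans_le hj.2)⟩
  omega

/-! ### Yield of the strategy for given advice -/

/-- The bins covered by the strategy, when the reserved bins get enough small items and the items
declared good are large enough. -/
theorem covered_ge {t : Tape} {p : Advice} (hpt : readAdvice t = p) {σ : List ℝ} (hσ : IsInput σ)
    {d : ℝ} (hp : p.plain = false) (hd0 : 0 < p.dUp) (hd : d ≤ p.dUp) (hs0 : 0 ≤ p.sUp)
    (hs : p.sDown ≤ p.sUp) (hextra : p.numBlack ≤ p.blackExtra)
    (hb : p.numBlack ≤ (σ.map (blackWeight p)).sum)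
    (hw : 2 * ((p.reserved : ℝ) - p.numBlack) * d ≤ (σ.map (truncWeight p d)).sum)
    {a e R N : ℕ} (ha : p.fillStart = a) (he : p.fillEnd = e) (hN : (twos σ).length = N)
    (hR : ∀ x < N, p.resume ≤ (x : ℕ∞) ↔ R ≤ x) (hae : a ≤ e) (heR : e ≤ R)
    (hr : e - a ≤ p.reserved) {U₁ U₂ : List ℝ} (hU₁ : ((twos σ).take e).drop a = U₁)
    (hU₂ : ((twos σ).drop R).take (p.reserved - (e - a)) = U₂)
    (hg : p.declared ≤ bigCount (1 - d) U₁) {m : ℕ}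
    (hm : min (min N R - e) (U₁.length - p.declared) = m) :
    (p.declared : ℝ) + m + bigCount (1 - d) U₂ + (N - U₁.length - U₂.length - m) / 2 - 1 / 2 +
      2 / 3 * ((σ.map smallPart).sum - 2 * (p.reserved - p.numBlack) * p.dUp -
        p.numBlack * p.sUp - 1) ≤ (modifiedDualHarmonic.covered t σ : ℝ) := by
  classical
  have sinv := smallInv_stateAfter (d := d) hp hd0 hd hs hextra σ hσ
  have tinv := twoInv_stateAfter hp ha he hR hae heR hr σ hσ hN.le
  have hgl := hg.trans (bigCount_le_length _ _)
  rw [hN, hU₁, hU₂, length_nonGood hgl, hm] at tinv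
  set s := stateAfter p σ
  set B := nonGood p.declared U₁
  have hBl : B.length = U₁.length - p.declared := length_nonGood hgl
  have hl1 : U₁.length ≤ e - a := by
    rw [← hU₁, List.length_drop, List.length_take]; omega
  have hl2 : U₂.length ≤ p.reserved - (e - a) := by
    rw [← hU₂, List.length_take]; omega
  have hsmall := sinv.le_active hs0
  have hload : ∀ i < U₁.length + U₂.length, d ≤ weightIn p smallPart σ (.reserved i) :=
    fun i hi => sinv.le_load hd hb hw (by omega)
  have hsn : ∀ j, 0 ≤ weightIn p smallPart σ j :=
    weightIn_nonneg fun x hx => smallPart_nonneg (hσ x hx).1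
  have htn : ∀ j, 0 ≤ weightIn p twoPart σ j :=
    weightIn_nonneg fun x hx => twoPart_nonneg (hσ x hx).1
  -- Three disjoint kinds of covered reserved bins: a good 2-item with small items (`T₁`), two
  -- 2-items (`T₂`), and a large 2-item placed after the resumption with small items (`T₃`).
  set T₁ := goodSet p.declared U₁ with hT₁
  set T₂ := (B.take m).toFinset with hT₂
  set T₃ := ((Finset.range U₂.length).filter fun i => 1 - d ≤ U₂.getD i 0).image (U₁.length + ·)
    with hT₃
  have c1 : T₁.card = p.declared := card_goodSet hgl
  have c2 : T₂.card = m := by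
    rw [hT₂, List.toFinset_card_of_nodup ((nonGood_nodup _ _).sublist (List.take_sublist _ _)),
      List.length_take, hBl]
    omega
  have c3 : T₃.card = bigCount (1 - d) U₂ := by
    rw [hT₃, Finset.card_image_of_injective _ (add_right_injective _), bigCount_eq_card]
  have m2 : ∀ i ∈ T₂, i ∈ B := fun i hi => List.mem_of_mem_take (List.mem_toFinset.1 hi)
  have m3 : ∀ i ∈ T₃, U₁.length ≤ i := by
    intro i hi
    obtain ⟨k, -, rfl⟩ := Finset.mem_image.1 hi
    exact Nat.le_add_right _ _
  have d12 : Disjoint T₁ T₂ := by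
    rw [Finset.disjoint_left]
    intro i h1 h2
    have h3 := (Finset.mem_filter.1 h1).2
    have h4 := (mem_nonGood.1 (m2 i h2)).2
    omega
  have d123 : Disjoint (T₁ ∪ T₂) T₃ := by
    rw [Finset.disjoint_left]
    intro i h1 h2
    have h3 := m3 i h2
    rcases Finset.mem_union.1 h1 with h1 | h1
    · have := Finset.mem_range.1 (Finset.mem_filter.1 h1).1
      omega
    · have := (mem_nonGood.1 (m2 i h1)).1
      omega
  have hcov := card_le_covered t σ (((T₁ ∪ T₂ ∪ T₃).image Bin.reserved ∪
    (Finset.range s.twoBins.active).image Bin.two) ∪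
    (Finset.range s.smallBins.active).image Bin.small) (by
      intro j hj
      rw [hpt, weightIn_id]
      rcases Finset.mem_union.1 hj with hj | hj
      · rcases Finset.mem_union.1 hj with hj | hj
        · obtain ⟨i, hi, rfl⟩ := Finset.mem_image.1 hj
          rcases Finset.mem_union.1 hi with hi | hi
          · rcases Finset.mem_union.1 hi with hi | hi
            · have h1 := le_of_mem_goodSet hg hi
              have h2 := Finset.mem_range.1 (Finset.mem_filter.1 hi).1
              have h3 := tinv.first_load i (by rw [List.length_append]; omega)
              rw [List.getD_append _ _ _ _ h2] at h3
              have h4 := hload i (by omega)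
              linarith
            · obtain ⟨q, hq, rfl⟩ := List.getElem_of_mem (List.mem_toFinset.1 hi)
              rw [List.length_take] at hq
              have h1 := tinv.matched_load q (by omega)
              rw [List.getD_eq_getElem _ _ (by omega)] at h1
              rw [List.getElem_take]
              have := hsn (.reserved B[q])
              linarith
          · obtain ⟨k, hk, rfl⟩ := Finset.mem_image.1 hi
            have h1 := (Finset.mem_filter.1 hk).2
            have h2 := Finset.mem_range.1 (Finset.mem_filter.1 hk).1
            have h3 := tinv.first_load (U₁.length + k) (by rw [List.length_append]; omega)
            rw [List.getD_append_right _ _ _ _ (Nat.le_add_right _ _),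
              Nat.add_sub_cancel_left] at h3
            have h4 := hload (U₁.length + k) (by omega)
            linarith
        · obtain ⟨i, hi, rfl⟩ := Finset.mem_image.1 hj
          have := tinv.sep_load i (Finset.mem_range.1 hi)
          have := hsn (.two i)
          linarith
      · obtain ⟨i, hi, rfl⟩ := Finset.mem_image.1 hj
        have := sinv.sep_load i (Finset.mem_range.1 hi)
        have := htn (.small i)
        linarith)
  rw [Finset.card_union_of_disjoint (by
      rw [Finset.disjoint_left]
      intro j hj hj'
      obtain ⟨i, -, rfl⟩ := Finset.mem_image.1 hj'
      simp at hj),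
    Finset.card_union_of_disjoint (by simp [Finset.disjoint_left]),
    Finset.card_image_of_injective _ (fun _ _ h => Bin.reserved.inj h),
    Finset.card_image_of_injective _ (fun _ _ h => Bin.two.inj h),
    Finset.card_image_of_injective _ (fun _ _ h => Bin.small.inj h),
    Finset.card_union_of_disjoint d123, Finset.card_union_of_disjoint d12, c1, c2, c3,
    Finset.card_range, Finset.card_range] at hcov
  -- The final 1 is the 2-item that may remain alone in the active separate bin; it causes the loss
  -- of `1 / 2`.
  have hcount : (N : ℝ) ≤ U₁.length + U₂.length + m + 2 * s.twoBins.active + 1 := by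
    have := tinv.count
    rw [hN, List.length_append] at this
    have h2 : N ≤ U₁.length + U₂.length + m + 2 * s.twoBins.active + 1 := by
      rcases this with h | h <;> omega
    exact_mod_cast h2
  have hcov' : (p.declared : ℝ) + m + bigCount (1 - d) U₂ + s.twoBins.active +
      s.smallBins.active ≤ modifiedDualHarmonic.covered t σ := by exact_mod_cast hcov
  linarith

/-! ### The optimum -/

/-- Order statistics: there is a `μ`-th smallest value. -/
theorem exists_order_statistic {ι : Type*} (A : Finset ι) (f : ι → ℝ) {μ : ℕ} (h0 : 0 < μ)
    (hμ : μ ≤ A.card) : ∃ a ∈ A, μ ≤ (A.filter fun x => f x ≤ f a).card ∧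
      (A.filter fun x => f x < f a).card < μ := by
  have hA : A.Nonempty := Finset.card_pos.1 (by omega)
  obtain ⟨b, hb, hbmax⟩ := A.exists_max_image f hA
  have hne : (A.filter fun a => μ ≤ (A.filter fun x => f x ≤ f a).card).Nonempty := by
    refine ⟨b, Finset.mem_filter.2 ⟨hb, ?_⟩⟩
    rwa [Finset.filter_true_of_mem hbmax]
  obtain ⟨a, ha, hamin⟩ := Finset.exists_min_image _ f hne
  obtain ⟨ha1, ha2⟩ := Finset.mem_filter.1 ha
  refine ⟨a, ha1, ha2, ?_⟩
  -- Otherwise the largest value below `f a` would already have `μ` values at or below it, against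
  -- the minimality of `a`.
  by_contra! hge
  have hne2 : (A.filter fun x => f x < f a).Nonempty := Finset.card_pos.1 (by omega)
  obtain ⟨c, hc, hcmax⟩ := Finset.exists_max_image _ f hne2
  obtain ⟨hc1, hc2⟩ := Finset.mem_filter.1 hc
  have h3 : μ ≤ (A.filter fun x => f x ≤ f c).card := by
    refine hge.trans (Finset.card_le_card fun x hx => ?_)
    exact Finset.mem_filter.2 ⟨(Finset.mem_filter.1 hx).1, hcmax x hx⟩
  exact absurd (hamin c (Finset.mem_filter.2 ⟨hc1, h3⟩)) (not_le.2 hc2)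

theorem sum_map_eq {M : Type*} [AddCommMonoid M] (σ : List ℝ) (g : ℝ → M) :
    (σ.map g).sum = ∑ i : Fin σ.length, g (σ.get i) := by
  exact (Fin.sum_univ_fun_getElem σ g).symm

theorem countP_eq_sum (σ : List ℝ) (P : ℝ → Prop) [DecidablePred P] :
    σ.countP (fun x => P x) = (σ.map fun x => if P x then 1 else 0).sum := by
  induction σ with
  | nil => simp
  | cons a l ih => rw [List.countP_cons, ih, List.map_cons, List.sum_cons, add_comm]; simp

theorem countP_eq_card (σ : List ℝ) (P : ℝ → Prop) [DecidablePred P] :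
    σ.countP (fun x => P x) = (Finset.univ.filter fun i : Fin σ.length => P (σ.get i)).card := by
  rw [countP_eq_sum, sum_map_eq, Finset.card_filter]

theorem length_twos (σ : List ℝ) :
    (twos σ).length = (Finset.univ.filter fun i : Fin σ.length => ¬ σ.get i < 1 / 2).card := by
  rw [← countP_eq_card σ (fun v => ¬ v < 1 / 2), List.countP_eq_length_filter]
  rfl

theorem countP_twos (σ : List ℝ) (P : ℝ → Prop) [DecidablePred P] :
    (twos σ).countP (fun x => P x) =
      (Finset.univ.filter fun i : Fin σ.length => P (σ.get i) ∧ ¬ σ.get i < 1 / 2).card := by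
  rw [← countP_eq_card σ (fun v => P v ∧ ¬ v < 1 / 2), twos, List.countP_filter]
  simp

/-- The structure of an optimal packing: `m` covered bins with exactly one 2-item and `k` without
2-items. If at most `J` 2-items are larger than `θ`, at least `m - J` of the `m` bins have small
items of total size at least `1 - θ`; `B` of these have a black item. -/
theorem opt_structure (σ : List ℝ) (hσ : IsInput σ) : ∃ m k : ℕ,
    2 * opt σ ≤ (twos σ).length + m + 2 * k ∧ m ≤ opt σ ∧ m ≤ (twos σ).length ∧
    (k : ℝ) ≤ (σ.map smallPart).sum ∧
    ∀ (θ : ℝ) (J : ℕ) (D : ℝ), θ < 1 →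
      (twos σ).countP (fun x => θ < x) ≤ J →
      ∃ M B : ℕ, m ≤ M + J ∧ M ≤ m ∧ B ≤ M ∧
        (∀ p : Advice, p.dUp = D →
          ((M : ℝ) - B) * (1 - θ) ≤ (σ.map (truncWeight p (1 - θ))).sum) ∧
        ∀ μ ≤ B, ∃ s, 0 ≤ s ∧ s < 1 / 2 ∧
          (∀ p : Advice, p.dUp = D → s ≤ p.sUp → μ ≤ (σ.map (blackWeight p)).sum) ∧
          k + ((M : ℝ) - B) * (1 - θ) + ((B : ℝ) - μ) * s ≤ (σ.map smallPart).sum := by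
  classical
  obtain ⟨f, -, hf⟩ := Finset.exists_mem_eq_sup
    (Finset.univ : Finset (Fin σ.length → Fin σ.length)) ⟨id, Finset.mem_univ _⟩
    (fun f => numCovered σ f)
  have hopt : opt σ = numCovered σ f := hf
  set x : Fin σ.length → ℝ := σ.get with hx
  have hx0 : ∀ i, 0 < x i := fun i => (hσ _ (List.getElem_mem i.2)).1
  set C := (Finset.univ.image f).filter fun j => 1 ≤ load σ f j with hC
  have hcard : opt σ = C.card := by
    rw [hopt, hC]
    unfold numCovered
    congr!
  have hCl : ∀ j ∈ C, 1 ≤ load σ f j := fun j hj => (Finset.mem_filter.1 hj).2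
  clear_value C
  set T : Fin σ.length → Finset (Fin σ.length) := fun j =>
    Finset.univ.filter fun i => f i = j ∧ ¬ x i < 1 / 2 with hT
  set S : Fin σ.length → ℝ := fun j =>
    ∑ i ∈ Finset.univ.filter (fun i => f i = j), smallPart (x i) with hS
  have fiber : ∀ g : Fin σ.length → ℝ,
      ∑ i, g i = ∑ j, ∑ i ∈ Finset.univ.filter (fun i => f i = j), g i :=
    fun g => (Finset.sum_fiberwise Finset.univ f g).symm
  have hS0 : ∀ j, 0 ≤ S j := fun j => Finset.sum_nonneg fun i _ => smallPart_nonneg (hx0 i)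
  have hload : ∀ j, load σ f j = S j + ∑ i ∈ T j, x i := by
    intro j
    have h1 : load σ f j = ∑ i ∈ Finset.univ.filter (fun i => f i = j), x i := by
      rw [Finset.sum_filter]
      exact Finset.sum_congr rfl fun i _ => by congr
    have h2 : ∑ i ∈ T j, x i = ∑ i ∈ Finset.univ.filter (fun i => f i = j), twoPart (x i) := by
      simp only [hT, twoPart]
      rw [← Finset.filter_filter, Finset.sum_filter]
      refine Finset.sum_congr rfl fun i _ => ?_
      split_ifs <;> simp_all
    rw [h1, h2, hS, ← Finset.sum_add_distrib]
    refine Finset.sum_congr rfl fun i _ => ?_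
    unfold smallPart twoPart
    split_ifs <;> simp
  have hW : (σ.map smallPart).sum = ∑ j, S j := by
    rw [sum_map_eq, fiber]
  -- The covered bins are split by their number of 2-items: none (`K`), one (`M₁`), at least two
  -- (`Q`). The bound on the optimum follows from `M₁.card + 2 * Q.card ≤ N`.
  set K := C.filter fun j => (T j).card = 0 with hK
  set M₁ := C.filter fun j => (T j).card = 1 with hM₁
  set Q := C.filter fun j => 2 ≤ (T j).card with hQ
  have hsplit : C.card = M₁.card + K.card + Q.card := by
    rw [hM₁, hK, hQ, Finset.card_filter, Finset.card_filter, Finset.card_filter,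
      ← Finset.sum_add_distrib, ← Finset.sum_add_distrib, Finset.card_eq_sum_ones]
    refine Finset.sum_congr rfl fun j _ => ?_
    split_ifs <;> omega
  have hNsum : (twos σ).length = ∑ j, (T j).card := by
    rw [length_twos, Finset.card_eq_sum_card_fiberwise (f := f) (t := Finset.univ)
      (fun _ _ => Finset.mem_coe.2 (Finset.mem_univ _))]
    refine Finset.sum_congr rfl fun j _ => ?_
    congr 1
    ext i
    simp only [hT, hx, Finset.mem_filter, Finset.mem_univ, true_and, and_comm]
  have hN : M₁.card + 2 * Q.card ≤ (twos σ).length := by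
    rw [hNsum]
    calc M₁.card + 2 * Q.card
        = ∑ j ∈ C, ((if (T j).card = 1 then 1 else 0) + 2 * if 2 ≤ (T j).card then 1 else 0) := by
          rw [Finset.sum_add_distrib, ← Finset.mul_sum, hM₁, hQ, Finset.card_filter,
            Finset.card_filter]
      _ ≤ ∑ j ∈ C, (T j).card := by
          refine Finset.sum_le_sum fun j _ => ?_
          split_ifs <;> omega
      _ ≤ ∑ j, (T j).card := Finset.sum_le_sum_of_subset (Finset.subset_univ _)
  have hKS : ∀ j ∈ K, 1 ≤ S j := by
    intro j hj
    obtain ⟨h1, h2⟩ := Finset.mem_filter.1 hj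
    have h3 := hCl j h1
    rw [hload, Finset.card_eq_zero.1 h2, Finset.sum_empty, add_zero] at h3
    exact h3
  have hKM : Disjoint K M₁ := by
    rw [Finset.disjoint_left]
    intro j h1 h2
    have h1 := (Finset.mem_filter.1 h1).2
    have h2 := (Finset.mem_filter.1 h2).2
    omega
  have hKsum : (K.card : ℝ) ≤ ∑ j ∈ K, S j := by
    simpa using Finset.card_nsmul_le_sum K S 1 hKS
  have hWKM : ∑ j ∈ K, S j + ∑ j ∈ M₁, S j ≤ (σ.map smallPart).sum := by
    rw [hW, ← Finset.sum_union hKM]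
    exact Finset.sum_le_sum_of_subset_of_nonneg (Finset.subset_univ _) fun j _ _ => hS0 j
  have hMS0 : 0 ≤ ∑ j ∈ M₁, S j := Finset.sum_nonneg fun j _ => hS0 j
  refine ⟨M₁.card, K.card, by omega, by omega, by omega, by linarith, ?_⟩
  intro θ J D hθ hJ
  -- `M'` consists of the bins that can supply a reserved bin with `1 - θ`; `A` consists of those
  -- among them that contain a black item.
  set M' := M₁.filter fun j => 1 - θ ≤ S j with hM'
  set A := M'.filter fun j => ∃ i, f i = j ∧ x i < 1 / 2 ∧ D ≤ x i with hA
  have hAM : A ⊆ M' := Finset.filter_subset _ _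
  have hM'M : M' ⊆ M₁ := Finset.filter_subset _ _
  have hdiff : ((M' \ A).card : ℝ) = M'.card - A.card := by
    rw [Finset.cast_card_sdiff hAM]
  have hMS : ∀ j ∈ M', 1 - θ ≤ S j := fun j hj => (Finset.mem_filter.1 hj).2
  have hdsum : ((M'.card : ℝ) - A.card) * (1 - θ) ≤ ∑ j ∈ M' \ A, S j := by
    have := Finset.card_nsmul_le_sum (M' \ A) S (1 - θ)
      fun j hj => hMS j (Finset.mem_sdiff.1 hj).1
    rwa [nsmul_eq_mul, hdiff] at this
  have hMA : ∑ j ∈ M' \ A, S j + ∑ j ∈ A, S j ≤ ∑ j ∈ M₁, S j := by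
    rw [Finset.sum_sdiff hAM]
    exact Finset.sum_le_sum_of_subset_of_nonneg hM'M fun j _ _ => hS0 j
  refine ⟨M'.card, A.card, ?_, Finset.card_le_card hM'M, Finset.card_le_card hAM, ?_, ?_⟩
  · rw [countP_twos] at hJ
    -- A bin of `M₁` with small items of total size below `1 - θ` is covered only thanks to a 2-item
    -- above `θ`, and different bins have different such items.
    have h1 : (M₁ \ M').card ≤ J := by
      refine (Finset.card_le_card ?_).trans ((Finset.card_image_le (f := f)).trans hJ)
      intro j hj
      obtain ⟨hj1, hj2⟩ := Finset.mem_sdiff.1 hj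
      obtain ⟨hj3, hj4⟩ := Finset.mem_filter.1 hj1
      obtain ⟨i, hi⟩ := Finset.card_eq_one.1 hj4
      have h2 : i ∈ T j := by rw [hi]; exact Finset.mem_singleton_self i
      obtain ⟨h3, h4⟩ := (Finset.mem_filter.1 h2).2
      have h5 := hCl j hj3
      rw [hload, hi, Finset.sum_singleton] at h5
      refine Finset.mem_image.2 ⟨i, Finset.mem_filter.2 ⟨Finset.mem_univ _, ?_, h4⟩, h3⟩
      by_contra! h6
      exact hj2 (Finset.mem_filter.2 ⟨hj1, by linarith⟩)
    have := Finset.card_sdiff_add_card_eq_card hM'M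
    omega
  · intro p hp
    have htrunc0 : ∀ i, 0 ≤ truncWeight p (1 - θ) (x i) := by
      intro i
      unfold truncWeight
      split_ifs
      · exact le_min (hx0 i).le (by linarith)
      · exact le_rfl
    rw [sum_map_eq, fiber]
    calc ((M'.card : ℝ) - A.card) * (1 - θ) = ∑ j ∈ M' \ A, (1 - θ) := by
          rw [Finset.sum_const, nsmul_eq_mul, hdiff]
      _ ≤ ∑ j ∈ M' \ A, ∑ i ∈ Finset.univ.filter (fun i => f i = j),
            truncWeight p (1 - θ) (x i) := by
          refine Finset.sum_le_sum fun j hj => ?_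
          obtain ⟨hj1, hj2⟩ := Finset.mem_sdiff.1 hj
          have hwhite : ∀ i, f i = j → x i < 1 / 2 → x i < D := by
            intro i h1 h2
            by_contra! h3
            exact hj2 (Finset.mem_filter.2 ⟨hj1, i, h1, h2, h3⟩)
          -- Truncation is harmless: either a single white item already counts `1 - θ`, or all small
          -- items of the bin are below `1 - θ` and count in full.
          by_cases hbig : ∃ i, f i = j ∧ x i < 1 / 2 ∧ 1 - θ ≤ x i
          · obtain ⟨i, h1, h2, h3⟩ := hbig
            calc 1 - θ = truncWeight p (1 - θ) (x i) := by
                  rw [truncWeight, if_pos ⟨h2, (hwhite i h1 h2).trans_eq hp.symm⟩, min_eq_right h3]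
              _ ≤ _ := Finset.single_le_sum (f := fun i => truncWeight p (1 - θ) (x i))
                  (fun i _ => htrunc0 i) (Finset.mem_filter.2 ⟨Finset.mem_univ i, h1⟩)
          · push Not at hbig
            refine (hMS j hj1).trans (Finset.sum_le_sum fun i hi => ?_)
            have h1 := (Finset.mem_filter.1 hi).2
            by_cases h2 : x i < 1 / 2
            · rw [truncWeight, if_pos ⟨h2, (hwhite i h1 h2).trans_eq hp.symm⟩, smallPart, if_pos h2]
              exact le_min le_rfl (hbig i h1 h2).le
            · rw [smallPart, if_neg h2]
              exact htrunc0 i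
      _ ≤ _ := Finset.sum_le_sum_of_subset_of_nonneg (Finset.subset_univ _)
          fun j _ _ => Finset.sum_nonneg fun i _ => htrunc0 i
  · intro μ hμ
    rcases Nat.eq_zero_or_pos μ with rfl | hμ0
    · refine ⟨0, le_rfl, by norm_num, fun _ _ _ => Nat.zero_le _, ?_⟩
      have : 0 ≤ ∑ j ∈ A, S j := Finset.sum_nonneg fun j _ => hS0 j
      linarith
    have hrep : ∀ j : Fin σ.length, ∃ i, j ∈ A → f i = j ∧ x i < 1 / 2 ∧ D ≤ x i := by
      intro j
      by_cases hj : j ∈ A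
      · obtain ⟨i, hi⟩ := (Finset.mem_filter.1 hj).2
        exact ⟨i, fun _ => hi⟩
      · exact ⟨j, fun h => absurd h hj⟩
    choose ρ hρ using hrep
    obtain ⟨a, ha, ha1, ha2⟩ := exists_order_statistic A (fun j => x (ρ j)) hμ0 hμ
    refine ⟨x (ρ a), (hx0 _).le, (hρ a ha).2.1, fun p hp hs => ?_, ?_⟩
    · rw [sum_map_eq]
      refine ha1.trans ?_
      simp only [blackWeight]
      rw [← Finset.card_filter]
      refine Finset.card_le_card_of_injOn ρ ?_ ?_
      · intro j hj
        obtain ⟨h1, h2⟩ := Finset.mem_filter.1 (Finset.mem_coe.1 hj)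
        have h3 := hρ j h1
        exact Finset.mem_coe.2 (Finset.mem_filter.2
          ⟨Finset.mem_univ _, h3.2.1, hp.trans_le h3.2.2, h2.trans hs⟩)
      · intro j hj j' hj' h
        have h1 := (hρ j (Finset.mem_filter.1 (Finset.mem_coe.1 hj)).1).1
        have h2 := (hρ j' (Finset.mem_filter.1 (Finset.mem_coe.1 hj')).1).1
        rw [← h1, ← h2, h]
    · have h1 : ((A.card : ℝ) - μ) * x (ρ a) ≤ ∑ j ∈ A, S j := by
        have h2 := Finset.card_filter_add_card_filter_not (s := A)
          (fun j => x (ρ j) < x (ρ a))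
        have h3 : ((A.card : ℝ) - μ) ≤ (A.filter fun j => ¬ x (ρ j) < x (ρ a)).card := by
          have : A.card ≤ μ + (A.filter fun j => ¬ x (ρ j) < x (ρ a)).card := by omega
          have : (A.card : ℝ) ≤ μ + (A.filter fun j => ¬ x (ρ j) < x (ρ a)).card := by
            exact_mod_cast this
          linarith
        calc ((A.card : ℝ) - μ) * x (ρ a)
            ≤ (A.filter fun j => ¬ x (ρ j) < x (ρ a)).card * x (ρ a) :=
              mul_le_mul_of_nonneg_right h3 (hx0 _).le
          _ = ∑ j ∈ A.filter fun j => ¬ x (ρ j) < x (ρ a), x (ρ a) := by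
              rw [Finset.sum_const, nsmul_eq_mul]
          _ ≤ ∑ j ∈ A.filter fun j => ¬ x (ρ j) < x (ρ a), S j := by
              refine Finset.sum_le_sum fun j hj => ?_
              obtain ⟨hj1, hj2⟩ := Finset.mem_filter.1 hj
              have h4 := hρ j hj1
              have h5 : smallPart (x (ρ j)) = x (ρ j) := if_pos h4.2.1
              refine (not_lt.1 hj2).trans ?_
              rw [← h5]
              exact Finset.single_le_sum (f := fun i => smallPart (x i))
                (fun i _ => smallPart_nonneg (hx0 i))
                (Finset.mem_filter.2 ⟨Finset.mem_univ _, h4.1⟩)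
          _ ≤ _ := Finset.sum_le_sum_of_subset_of_nonneg (Finset.filter_subset _ _)
              fun j _ _ => hS0 j
      linarith

/-- The `j`-th largest entry of a list. -/
theorem exists_threshold (u : List ℝ) {j : ℕ} (hj0 : 0 < j) (hj : j ≤ u.length) :
    ∃ θ ∈ u, j ≤ bigCount θ u ∧ u.countP (fun x => θ < x) ≤ j := by
  -- Sizes are negated to turn smallest into largest. Because of ties, the entries at least `θ` and
  -- those above `θ` must be counted separately.
  obtain ⟨i, -, h1, h2⟩ := exists_order_statistic (Finset.univ : Finset (Fin u.length))
    (fun i => - u.get i) hj0 (by simpa using hj)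
  refine ⟨u.get i, List.getElem_mem i.2, ?_, ?_⟩
  · rw [bigCount, countP_eq_card u (fun x => u.get i ≤ x)]
    simpa using h1
  · rw [countP_eq_card u (fun x => u.get i < x)]
    simpa using h2.le

theorem half_le_of_mem_twos {σ : List ℝ} {x : ℝ} (hx : x ∈ twos σ) : 1 / 2 ≤ x := by
  simpa [twos] using (List.mem_filter.1 hx).2

theorem mem_of_mem_twos {σ : List ℝ} {x : ℝ} (hx : x ∈ twos σ) : x ∈ σ :=
  (List.mem_filter.1 hx).1

theorem length_twos_le (σ : List ℝ) : (twos σ).length ≤ σ.length := List.length_filter_le _ _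

/-- Fixed point approximation with `b` fractional bits. -/
theorem exists_fixed_point (b : ℕ) {v : ℝ} (h0 : 0 ≤ v) (h1 : v < 1) :
    ∃ x : ℕ, x < 2 ^ b ∧ v ≤ ((x : ℝ) + 1) / 2 ^ b ∧
      ((x : ℝ) + 1) / 2 ^ b ≤ v + 1 / 2 ^ b := by
  have hb : (0 : ℝ) < 2 ^ b := by positivity
  have hv : 0 ≤ v * 2 ^ b := by positivity
  have hf := Nat.floor_le hv
  have hl := Nat.lt_floor_add_one (v * 2 ^ b)
  have hx : ((⌊v * 2 ^ b⌋₊ : ℕ) : ℝ) / 2 ^ b ≤ v := by rwa [div_le_iff₀ hb]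
  refine ⟨⌊v * 2 ^ b⌋₊, ?_, ?_, ?_⟩
  · have : ((⌊v * 2 ^ b⌋₊ : ℕ) : ℝ) < ((2 ^ b : ℕ) : ℝ) := by
      push_cast
      nlinarith
    exact_mod_cast this
  · rw [le_div_iff₀ hb]; exact hl.le
  · rw [add_div]; linarith

/-! ### Supplying the reserved bins with small items -/

/-- The part of an optimal packing that is relevant for the small items: `M` bins with small items
of total size at least `1 - θ`, of which `B` have a black item. -/
def SmallSupply (σ : List ℝ) (k : ℕ) (θ D : ℝ) (M B : ℕ) : Prop :=
  (∀ p : Advice, p.dUp = D →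
    ((M : ℝ) - B) * (1 - θ) ≤ (σ.map (truncWeight p (1 - θ))).sum) ∧
  ∀ μ ≤ B, ∃ s, 0 ≤ s ∧ s < 1 / 2 ∧
    (∀ p : Advice, p.dUp = D → s ≤ p.sUp → μ ≤ (σ.map (blackWeight p)).sum) ∧
    k + ((M : ℝ) - B) * (1 - θ) + ((B : ℝ) - μ) * s ≤ (σ.map smallPart).sum

/-- Advice on the small items: `r` reserved bins get enough small items, at the expense of at most
about as much as is used by the optimal packing together with its 2-items. -/
theorem exists_small_advice {σ : List ℝ} {b k r M B : ℕ} (hb : 1 ≤ b)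
    (hB : B < 2 ^ (2 ^ b)) (hr : Representable b r) {θ D : ℝ} (hθ1 : θ < 1)
    (hD : D ≤ 1 - θ + 1 / 2 ^ b) (hBM : B ≤ M)
    (hM : 2 * (r : ℝ) + 2 + 2 * r * (2 / 2 ^ b) ≤ M) (hs : SmallSupply σ k θ D M B) :
    ∃ black y : ℕ, Representable b black ∧ y < 2 ^ b ∧
      ∀ p : Advice, p.reserved = r → p.black = black → p.dUp = D →
        p.sUp = ((y : ℝ) + 1) / 2 ^ b →
        p.numBlack ≤ (σ.map (blackWeight p)).sum ∧
        2 * ((p.reserved : ℝ) - p.numBlack) * (1 - θ) ≤ (σ.map (truncWeight p (1 - θ))).sum ∧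
        (k : ℝ) - r * (2 / 2 ^ b) ≤ (σ.map smallPart).sum -
          2 * (p.reserved - p.numBlack) * p.dUp - p.numBlack * p.sUp := by
  obtain ⟨hs1, hs2⟩ := hs
  -- `μ` is half the number of supplying bins with a black item, rounded down, or `r` if that
  -- suffices. The surplus in `hM` over `2 * r` absorbs halving and rounding, so that the all-white
  -- bins number at least `2 * (r - μ)`.
  obtain ⟨μ, hμ, hμr, hμB, hμM⟩ : ∃ μ, Representable b μ ∧ μ ≤ r ∧ 2 * μ ≤ B ∧
      2 * ((r : ℝ) - μ) ≤ M - B := by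
    by_cases h : 2 * r ≤ B
    · refine ⟨r, hr, le_rfl, h, ?_⟩
      have : (B : ℝ) ≤ M := by exact_mod_cast hBM
      linarith
    · push Not at h
      obtain ⟨μ, h1, h2, h3⟩ := exists_representable (b := b) (v := B / 2) hb (by omega)
      refine ⟨μ, h1, by omega, by omega, ?_⟩
      have h4 : (B : ℝ) ≤ 2 * (B / 2 : ℕ) + 1 := by
        exact_mod_cast (show B ≤ 2 * (B / 2) + 1 by omega)
      have h5 : ((B / 2 : ℕ) : ℝ) ≤ r := by exact_mod_cast (show B / 2 ≤ r by omega)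
      have h6 : ((B / 2 : ℕ) : ℝ) * (2 / 2 ^ b) ≤ r * (2 / 2 ^ b) :=
        mul_le_mul_of_nonneg_right h5 (by positivity)
      linarith
  obtain ⟨s, hs0, hs12, hs3, hs4⟩ := hs2 μ (by omega)
  obtain ⟨y, hy, hy2, hy3⟩ := exists_fixed_point b hs0 (by linarith)
  refine ⟨μ, y, hμ, hy, fun p hpr hpb hpd hps => ?_⟩
  have hnb : p.numBlack = μ := by rw [Advice.numBlack, hpb, hpr]; omega
  have hμr' : (μ : ℝ) ≤ r := by exact_mod_cast hμr
  have hμB' : 2 * (μ : ℝ) ≤ B := by exact_mod_cast hμB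
  have hμ0 : (0 : ℝ) ≤ μ := μ.cast_nonneg
  have hd : 2 * ((r : ℝ) - μ) * (1 - θ) ≤ (M - B) * (1 - θ) :=
    mul_le_mul_of_nonneg_right hμM (by linarith)
  rw [hnb, hpr, hpd]
  refine ⟨hs3 p hpd (hps ▸ hy2), hd.trans (hs1 p hpd), ?_⟩
  have h1 : 2 * ((r : ℝ) - μ) * D ≤ 2 * (r - μ) * (1 - θ + 1 / 2 ^ b) :=
    mul_le_mul_of_nonneg_left hD (by linarith)
  have h2 : (μ : ℝ) * p.sUp ≤ μ * (s + 1 / 2 ^ b) :=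
    mul_le_mul_of_nonneg_left (hps ▸ hy3) hμ0
  -- The black items used are paid for by the `B - μ ≥ μ` bins whose black item has size at least
  -- `s`.
  have h3 : (μ : ℝ) * s ≤ (B - μ) * s := mul_le_mul_of_nonneg_right (by linarith) hs0
  have h4 : 0 ≤ (μ : ℝ) * (1 / 2 ^ b) := by positivity
  have h5 : (r : ℝ) * (2 / 2 ^ b) = 2 * r * (1 / 2 ^ b) := by ring
  rw [h5]
  nlinarith

/-! ### Prefix counts and encoded advice -/

/-- Number of entries of size at least `θ` among the first `i`. -/
noncomputable def prefixCount (θ : ℝ) (u : List ℝ) (i : ℕ) : ℕ := bigCount θ (u.take i)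

theorem bigCount_take_drop (θ : ℝ) (u : List ℝ) {a e : ℕ} (hae : a ≤ e) :
    prefixCount θ u e = prefixCount θ u a + bigCount θ ((u.take e).drop a) := by
  unfold prefixCount
  rw [← bigCount_append]
  congr 1
  conv_lhs => rw [← List.take_append_drop a (u.take e), List.take_take, min_eq_left hae]

theorem bigCount_drop_take (θ : ℝ) (u : List ℝ) (R l : ℕ) :
    prefixCount θ u (R + l) = prefixCount θ u R + bigCount θ ((u.drop R).take l) := by
  rw [bigCount_take_drop θ u (Nat.le_add_right R l), List.drop_take, Nat.add_sub_cancel_left]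

theorem prefixCount_le (θ : ℝ) (u : List ℝ) {a e : ℕ} (hae : a ≤ e) :
    prefixCount θ u e ≤ prefixCount θ u a + (e - a) := by
  rw [bigCount_take_drop θ u hae]
  have := bigCount_le_length θ ((u.take e).drop a)
  rw [List.length_drop, List.length_take] at this
  omega

theorem prefixCount_mono (θ : ℝ) (u : List ℝ) {a e : ℕ} (hae : a ≤ e) :
    prefixCount θ u a ≤ prefixCount θ u e := by
  rw [bigCount_take_drop θ u hae]
  exact Nat.le_add_right _ _

theorem prefixCount_min_length (θ : ℝ) (u : List ℝ) (i : ℕ) :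
    prefixCount θ u (min u.length i) = prefixCount θ u i := by
  unfold prefixCount
  congr 1
  rcases le_total u.length i with h | h
  · rw [min_eq_left h, List.take_length, List.take_of_length_le h]
  · rw [min_eq_right h]

/-- The advice values, given the numbers written on the tape. -/
noncomputable def codedAdvice (b r black x y part variant good L R : ℕ) : Advice :=
  -- The quota `blackExtra` equals `black`, so it never binds: every black item of size at most
  -- `sUp` is accepted while a black bin is free.
  ⟨false, part, variant, r, good, L, R, black, black, ((x : ℝ) + 1) / 2 ^ b, (y : ℝ) / 2 ^ b,
    ((y : ℝ) + 1) / 2 ^ b⟩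

/-- The values `r`, `black`, `x`, `y` provide every reserved bin with small items of total size at
least `1 - θ`, and the separate bins with small items of total size about `k`. -/
structure GoodForSmall (σ : List ℝ) (b k r : ℕ) (θ : ℝ) (black x y : ℕ) : Prop where
  rep_r : Representable b r
  rep_black : Representable b black
  x_lt : x < 2 ^ b
  y_lt : y < 2 ^ b
  le_dUp : 1 - θ ≤ ((x : ℝ) + 1) / 2 ^ b
  enough : ∀ part variant good L R,
    let p := codedAdvice b r black x y part variant good L R
    p.numBlack ≤ (σ.map (blackWeight p)).sum ∧
    2 * ((p.reserved : ℝ) - p.numBlack) * (1 - θ) ≤ (σ.map (truncWeight p (1 - θ))).sum ∧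
    (k : ℝ) - r * (2 / 2 ^ b) ≤ (σ.map smallPart).sum -
      2 * (p.reserved - p.numBlack) * p.dUp - p.numBlack * p.sUp

variable {σ : List ℝ} {b k r : ℕ} {θ : ℝ} {black x y : ℕ}

/-- Counting large items in prefixes makes the yield of each case a linear expression in a few
common quantities, so that the comparison of the cases becomes linear arithmetic. -/
theorem GoodForSmall.covered_ge (S : GoodForSmall σ b k r θ black x y) (hσ : IsInput σ)
    {part variant good L R : ℕ} (h1 : part < 4) (h2 : variant < 4) (h3 : Representable b good)
    (h4 : Representable b L) (h5 : Representable b R) {a e T N : ℕ} (hN : (twos σ).length = N)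
    {g : ℕ} (hdecl : (codedAdvice b r black x y part variant good L R).declared = g)
    (ha : (codedAdvice b r black x y part variant good L R).fillStart = a)
    (he : (codedAdvice b r black x y part variant good L R).fillEnd = e)
    (hT : ∀ i < N, (codedAdvice b r black x y part variant good L R).resume ≤ (i : ℕ∞) ↔ T ≤ i)
    (hae : a ≤ e) (heT : e ≤ T) (heN : e ≤ N) (hr : e - a ≤ r)
    (hg : prefixCount θ (twos σ) a + g ≤ prefixCount θ (twos σ) e) :
    ∃ t : Tape, (g : ℝ) + (min (min N T - e) (e - a - g) : ℕ) +
      ((prefixCount θ (twos σ) (T + (r - (e - a))) : ℝ) - prefixCount θ (twos σ) T) +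
      (N - ((e : ℝ) - a) - (min (r - (e - a)) (N - T) : ℕ) -
        (min (min N T - e) (e - a - g) : ℕ)) / 2 - 1 / 2 +
      2 / 3 * (k - r * (2 / 2 ^ b) - 1) ≤
        (modifiedDualHarmonic.covered (selfDelimited b t) σ : ℝ) := by
  obtain ⟨t, ht⟩ := exists_decode_eq b part variant r good L R black black x y h1 h2 S.rep_r h3 h4
    h5 S.rep_black S.rep_black S.x_lt S.y_lt
  refine ⟨t, ?_⟩
  obtain ⟨e1, e2, e3⟩ := S.enough part variant good L R
  set p := codedAdvice b r black x y part variant good L R with hp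
  have hl1 : (((twos σ).take e).drop a).length = e - a := by
    rw [List.length_drop, List.length_take]; omega
  have hl2 : (((twos σ).drop T).take (r - (e - a))).length = min (r - (e - a)) (N - T) := by
    rw [List.length_take, List.length_drop, hN]
  have c1 := bigCount_take_drop θ (twos σ) hae
  have c2 := bigCount_drop_take θ (twos σ) T (r - (e - a))
  have hpt : readAdvice (selfDelimited b t) = p := by rw [readAdvice_selfDelimited, ht]; rfl
  have hs : p.sDown ≤ p.sUp := by
    change (y : ℝ) / 2 ^ b ≤ ((y : ℝ) + 1) / 2 ^ b
    gcongr
    linarith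
  have h := BinCovering.covered_ge hpt hσ (d := 1 - θ) rfl
    (show (0 : ℝ) < ((x : ℝ) + 1) / 2 ^ b by positivity) S.le_dUp
    (show (0 : ℝ) ≤ ((y : ℝ) + 1) / 2 ^ b by positivity) hs (min_le_left _ _) e1 e2 ha he hN hT
    hae heT hr rfl rfl (by rw [hdecl, sub_sub_cancel]; omega) rfl
  rw [hdecl, sub_sub_cancel] at h
  rw [show p.reserved = r from rfl] at h e3
  rw [hl1, hl2, Nat.cast_sub hae] at h
  have c3 : (prefixCount θ (twos σ) (T + (r - (e - a))) : ℝ) = prefixCount θ (twos σ) T +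
      bigCount θ (((twos σ).drop T).take (r - (e - a))) := by exact_mod_cast c2
  linarith

/-! ### Yield of each case for the 2-items -/

/-- One of the first three subsequences goes to the reserved bins. -/
theorem GoodForSmall.window (S : GoodForSmall σ b k r θ black x y) (hσ : IsInput σ)
    {q good g : ℕ} (hq : q < 3) (h3 : Representable b good) (hgood : good - 1 = g)
    (hN : 4 * r ≤ (twos σ).length)
    (hg : prefixCount θ (twos σ) (q * r) + g ≤ prefixCount θ (twos σ) ((q + 1) * r)) :
    ∃ t : Tape, ((twos σ).length : ℝ) / 2 + g / 2 - 1 / 2 + 2 / 3 * (k - r * (2 / 2 ^ b) - 1) ≤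
        (modifiedDualHarmonic.covered (selfDelimited b t) σ : ℝ) := by
  have hle : q * r ≤ (q + 1) * r := Nat.mul_le_mul_right _ (Nat.le_succ q)
  have he : (q + 1) * r = q * r + r := by ring
  have he3 : q * r ≤ 2 * r := Nat.mul_le_mul_right _ (by omega)
  obtain ⟨t, ht⟩ := S.covered_ge hσ (part := q) (variant := 0) (good := good) (L := 0) (R := 0)
    (a := q * r) (e := (q + 1) * r) (T := (twos σ).length) (N := (twos σ).length) (g := g)
    (by omega) (by norm_num)
    h3 (Representable.zero b) (Representable.zero b) rfl
    (by simp [Advice.declared, codedAdvice, hgood]) (by simp [Advice.fillStart, codedAdvice, hq])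
    (by simp [Advice.fillEnd, codedAdvice, hq])
    (fun i hi => by simp [Advice.resume, codedAdvice, hq, hi]) hle (by omega) (by omega)
    (by omega) hg
  refine ⟨t, le_trans ?_ ht⟩
  have hgr : g ≤ r := by
    have := prefixCount_le θ (twos σ) hle
    omega
  -- Since `4 * r ≤ N`, at least `r` 2-items follow the window, enough to complete all `r - g` bins
  -- not declared good.
  have hm : min (min (twos σ).length (twos σ).length - (q + 1) * r) ((q + 1) * r - q * r - g) =
      r - g := by omega
  have hm2 : (q + 1) * r - q * r = r := by omega
  rw [hm, hm2, Nat.sub_self, Nat.sub_self, Nat.zero_min, Nat.add_zero, Nat.cast_sub hgr]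
  push_cast
  linarith

/-- The first two chunks of the last subsequence go to the reserved bins. -/
theorem GoodForSmall.first_chunks (S : GoodForSmall σ b k r θ black x y) (hσ : IsInput σ)
    {good g L R : ℕ} (h3 : Representable b good) (hL : Representable b L)
    (hR : Representable b R) (hgood : good - 1 = g) (hLR : L + R ≤ r)
    (hN : 4 * r ≤ (twos σ).length)
    (hg : prefixCount θ (twos σ) (3 * r) + g ≤ prefixCount θ (twos σ) (3 * r + L + R)) :
    ∃ t : Tape, ((twos σ).length : ℝ) / 2 +
      min ((g : ℝ) / 2) (g + ((twos σ).length - 5 * r) / 2) - 1 / 2 +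
        2 / 3 * (k - r * (2 / 2 ^ b) - 1) ≤
        (modifiedDualHarmonic.covered (selfDelimited b t) σ : ℝ) := by
  obtain ⟨t, ht⟩ := S.covered_ge hσ (part := 3) (variant := 0) (good := good) (L := L) (R := R)
    (a := 3 * r) (e := 3 * r + L + R) (T := (twos σ).length) (N := (twos σ).length) (g := g)
    (by omega) (by norm_num)
    h3 hL hR rfl
    (by simp [Advice.declared, codedAdvice, hgood]) (by simp [Advice.fillStart, codedAdvice])
    (by simp [Advice.fillEnd, codedAdvice])
    (fun i hi => by simp [Advice.resume, codedAdvice, hi]) (by omega) (by omega) (by omega)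
    (by omega) hg
  refine ⟨t, le_trans ?_ ht⟩
  have hgr : g ≤ L + R := by
    have := prefixCount_le θ (twos σ) (show 3 * r ≤ 3 * r + L + R by omega)
    omega
  have hLR' : (L : ℝ) + R ≤ r := by exact_mod_cast hLR
  have c0 : prefixCount θ (twos σ) ((twos σ).length + (r - (3 * r + L + R - 3 * r))) =
      prefixCount θ (twos σ) (twos σ).length := by
    rw [← prefixCount_min_length, min_eq_left (Nat.le_add_right _ _)]
  rw [c0, Nat.sub_self, Nat.min_zero, min_self]
  -- The third chunk may be too short to complete all bins not declared good. Then all its items are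
  -- used for completion, and the second term of the minimum bounds the yield.
  rcases le_total (L + R - g) ((twos σ).length - (3 * r + L + R)) with h | h
  · have hm : min ((twos σ).length - (3 * r + L + R)) (3 * r + L + R - 3 * r - g) =
      L + R - g := by omega
    rw [hm, Nat.cast_sub hgr]
    have := min_le_left ((g : ℝ) / 2) (g + ((twos σ).length - 5 * r) / 2)
    push_cast
    linarith
  · have hm : min ((twos σ).length - (3 * r + L + R)) (3 * r + L + R - 3 * r - g) =
      (twos σ).length - (3 * r + L + R) := by omega
    rw [hm, Nat.cast_sub (by omega)]
    have := min_le_right ((g : ℝ) / 2) (g + ((twos σ).length - 5 * r) / 2)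
    push_cast
    linarith

/-- The first chunk of the last subsequence is matched with the second, and the third goes to
the remaining reserved bins. -/
theorem GoodForSmall.outer_chunks (S : GoodForSmall σ b k r θ black x y) (hσ : IsInput σ)
    {g L R : ℕ} (h3 : Representable b g) (hL : Representable b L)
    (hR : Representable b R) (hLR : L + R ≤ r) (hgR : L - g ≤ R)
    (hN : 4 * r ≤ (twos σ).length)
    (hg : prefixCount θ (twos σ) (3 * r) + g ≤ prefixCount θ (twos σ) (3 * r + L)) :
    ∃ t : Tape, ∃ l : ℕ, l = min (r - L) ((twos σ).length - (3 * r + L + R)) ∧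
      ((twos σ).length : ℝ) / 2 + (g / 2 +
        (prefixCount θ (twos σ) (3 * r + L + R + l) - prefixCount θ (twos σ) (3 * r + L + R)) -
        l / 2) - 1 / 2 + 2 / 3 * (k - r * (2 / 2 ^ b) - 1) ≤
        (modifiedDualHarmonic.covered (selfDelimited b t) σ : ℝ) := by
  obtain ⟨t, ht⟩ := S.covered_ge hσ (part := 3) (variant := 1) (good := g) (L := L) (R := R)
    (a := 3 * r) (e := 3 * r + L) (T := 3 * r + L + R) (N := (twos σ).length) (g := g)
    (by omega) (by norm_num)
    h3 hL hR rfl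
    (by simp [Advice.declared, codedAdvice]) (by simp [Advice.fillStart, codedAdvice])
    (by simp [Advice.fillEnd, codedAdvice])
    (fun i hi => by
      simp only [Advice.resume, codedAdvice, lt_irrefl, if_false, one_ne_zero, if_true]
      exact_mod_cast Iff.rfl) (by omega) (by omega) (by omega)
    (by omega) hg
  refine ⟨t, _, rfl, le_trans ?_ ht⟩
  have hgr : g ≤ L := by
    have := prefixCount_le θ (twos σ) (show 3 * r ≤ 3 * r + L by omega)
    omega
  have e1 : 3 * r + L - 3 * r = L := by omega
  -- By `hgR` the second chunk is long enough to complete every bin of the first chunk that was not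
  -- declared good.
  have hm : min (min (twos σ).length (3 * r + L + R) - (3 * r + L)) (L - g) = L - g := by omega
  have c0 : prefixCount θ (twos σ) (3 * r + L + R + (r - L)) = prefixCount θ (twos σ)
      (3 * r + L + R + min (r - L) ((twos σ).length - (3 * r + L + R))) := by
    rw [← prefixCount_min_length]
    congr 1
    omega
  rw [e1, hm, c0, Nat.cast_sub hgr]
  push_cast
  linarith

/-- All but the first chunk of the last subsequence go to the reserved bins. -/
theorem GoodForSmall.last_chunks (S : GoodForSmall σ b k r θ black x y) (hσ : IsInput σ)
    {L : ℕ} (hL : Representable b L) (hLr : L ≤ r) (hN : 4 * r ≤ (twos σ).length) :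
    ∃ t : Tape, ∃ l : ℕ, l = min r ((twos σ).length - (3 * r + L)) ∧
      ((twos σ).length : ℝ) / 2 +
        ((prefixCount θ (twos σ) (3 * r + L + l) - prefixCount θ (twos σ) (3 * r + L)) -
        l / 2) - 1 / 2 + 2 / 3 * (k - r * (2 / 2 ^ b) - 1) ≤
        (modifiedDualHarmonic.covered (selfDelimited b t) σ : ℝ) := by
  obtain ⟨t, ht⟩ := S.covered_ge hσ (part := 3) (variant := 2) (good := 0) (L := L) (R := 0)
    (a := 3 * r + L) (e := 3 * r + L) (T := 3 * r + L) (N := (twos σ).length) (g := 0)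
    (by omega) (by norm_num)
    (Representable.zero b) hL (Representable.zero b) rfl
    (by simp [Advice.declared, codedAdvice]) (by simp [Advice.fillStart, codedAdvice])
    (by simp [Advice.fillEnd, codedAdvice])
    (fun i hi => by
      simp only [Advice.resume, codedAdvice, lt_irrefl, if_false, OfNat.ofNat_ne_zero,
        OfNat.ofNat_ne_one]
      exact_mod_cast Iff.rfl) (by omega) (by omega) (by omega)
    (by omega) le_rfl
  refine ⟨t, _, rfl, le_trans ?_ ht⟩
  have c0 : prefixCount θ (twos σ) (3 * r + L + r) = prefixCount θ (twos σ)
      (3 * r + L + min r ((twos σ).length - (3 * r + L))) := by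
    rw [← prefixCount_min_length]
    congr 1
    omega
  rw [Nat.sub_self, Nat.sub_zero, Nat.min_zero, Nat.sub_zero, c0]
  push_cast
  linarith

/-- No reserved bins. -/
theorem GoodForSmall.plain (S : GoodForSmall σ b k 0 θ black x y) (hσ : IsInput σ) :
    ∃ t : Tape, ((twos σ).length : ℝ) / 2 - 1 / 2 + 2 / 3 * (k - 1) ≤
        (modifiedDualHarmonic.covered (selfDelimited b t) σ : ℝ) := by
  -- A window of length zero: with no reserved bins everything is packed separately, so the `plain`
  -- flag is not needed.
  obtain ⟨t, ht⟩ := S.window hσ (q := 0) (good := 0) (g := 0) (by norm_num)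
    (Representable.zero b) rfl (by omega) (by simp)
  refine ⟨t, le_trans ?_ ht⟩
  push_cast
  linarith

/-! ### Comparison of the cases -/

/-- If the first three subsequences, the first two chunks and the last two chunks of the last one
have few large 2-items, most items of the first chunk are large. -/
theorem chunk_arith {m N G r L R j E C₁ C₂ C₃ CL CN l D : ℝ} (hE : 1 ≤ E) (hNm : m ≤ N)
    (hG : G = 135 / 242 * (m + N) - N) (hGE : 1000 * E < G)
    (hr' : 27 / 121 * m - E ≤ r) (hR' : 13 / 27 * r - E ≤ R)
    (hj : m - 2 * r - 3 * E ≤ j) (hjC : j ≤ CN) (w₀ : C₁ < G - 15 * E) (w₁ : C₂ - C₁ < G - 15 * E)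
    (w₂ : C₃ - C₂ < G - 15 * E)
    (v₂ : 2 * (D - CL) - l < G - 15 * E) (hl : 26 / 121 * m - E ≤ l)
    (hD : CN - D ≤ N - (3 * r + L) - l) : L - (CL - C₃) ≤ R - 2 * E := by
  subst hG
  linarith

/-- The constants 27, 14 and 13 over 121 make all cases tight simultaneously when `m = N`. Each
failed case loses at most a fixed multiple of `E`, and `1000 * E < G` provides the slack; for `m <
N` the decrease of `G` outweighs the additional 2-items. -/
theorem chunk_contradiction {m N G r L R j E C₁ C₂ C₃ CL CR CN l D l' D' : ℝ} (hE : 1 ≤ E)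
    (hNm : m ≤ N)
    (hG : G = 135 / 242 * (m + N) - N) (hGE : 1000 * E < G)
    (hr' : 27 / 121 * m - E ≤ r) (hL' : 14 / 27 * r - E ≤ L) (hR' : 13 / 27 * r - E ≤ R)
    (hj : m - 2 * r - 3 * E ≤ j) (hjC : j ≤ CN) (w₀ : C₁ < G - 15 * E) (w₁ : C₂ - C₁ < G - 15 * E)
    (w₂ : C₃ - C₂ < G - 15 * E) (v₀ : CR - C₃ < G - 15 * E)
    (v₂ : 2 * (D - CL) - l < G - 15 * E) (hl : 26 / 121 * m - E ≤ l)
    (hD : CN - D ≤ N - (3 * r + L) - l)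
    (v₁ : (CL - C₃) + 2 * (D' - CR) - l' < G - 15 * E) (hl' : 13 / 121 * m - E ≤ l')
    (hD' : CN - D' ≤ N - (3 * r + L + R) - l') : False := by
  subst hG
  linarith

/-- Without reserved bins and with `θ = 1` nothing is demanded of the small items; this serves the
case of small `G`. -/
theorem goodForSmall_zero {σ : List ℝ} (hσ : IsInput σ) {b k : ℕ}
    (hk : (k : ℝ) ≤ (σ.map smallPart).sum) : GoodForSmall σ b k 0 1 0 0 0 where
  rep_r := Representable.zero b
  rep_black := Representable.zero b
  x_lt := by positivity
  y_lt := by positivity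
  le_dUp := by rw [sub_self]; positivity
  enough := by
    intro part variant good L R p
    have h1 : p.numBlack = 0 := rfl
    have h2 : p.reserved = 0 := rfl
    rw [h1, h2, sub_self]
    refine ⟨Nat.zero_le _, ?_, ?_⟩
    · rw [mul_zero, zero_mul]
      apply List.sum_nonneg
      intro z hz
      obtain ⟨v, hv, rfl⟩ := List.mem_map.1 hz
      unfold truncWeight
      split_ifs
      · exact le_min (hσ v hv).1.le (sub_self (1 : ℝ)).ge
      · exact le_rfl
    · push_cast
      linarith

/-- Some choice of the reserved subsequence leads to a large number of covered bins. -/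
theorem GoodForSmall.exists_tape {σ : List ℝ} {b k r : ℕ} {θ : ℝ} {black x y : ℕ}
    (S : GoodForSmall σ b k r θ black x y) (hσ : IsInput σ) {m L R : ℕ} {E G j : ℝ}
    (hround : ∀ v ≤ m, ∃ w, Representable b w ∧ w ≤ v ∧ (v : ℝ) ≤ w + (E - 1))
    (hL : Representable b L) (hR : Representable b R) (hE1 : 1 ≤ E)
    (hmN' : (m : ℝ) ≤ (twos σ).length) (hrm3 : r + 1 ≤ m) (h4r : 4 * r ≤ (twos σ).length)
    (hLRr : L + R ≤ r) (hG : G = 135 / 242 * ((m : ℝ) + (twos σ).length) - (twos σ).length)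
    (hGE : 1000 * E < G)
    (hr1 : (r : ℝ) ≤ 27 / 121 * m) (hr2 : 27 / 121 * (m : ℝ) - E ≤ r)
    (hL1 : (L : ℝ) ≤ 14 / 27 * r) (hL2 : 14 / 27 * (r : ℝ) - E ≤ L)
    (hR1 : (R : ℝ) ≤ 13 / 27 * r) (hR2 : 13 / 27 * (r : ℝ) - E ≤ R)
    (hrε : (r : ℝ) * (2 / 2 ^ b) ≤ E - 1) (hjm : (m : ℝ) - 2 * r - 3 * E ≤ j)
    (hcN : j ≤ prefixCount θ (twos σ) (twos σ).length) :
    ∃ t : Tape, ((twos σ).length : ℝ) / 2 + G / 2 + 2 / 3 * k - 20 * E ≤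
      (modifiedDualHarmonic.covered (selfDelimited b t) σ : ℝ) := by
  set u := twos σ with hu
  set N := u.length with hN
  by_contra! hfail
  set c := prefixCount θ u with hc
  have hc0 : c 0 = 0 := by simp [hc, prefixCount, bigCount]
  -- In these cases one less than the written number is declared good, so the number of large items
  -- plus one is rounded; rounding down ensures that only large items are declared good.
  have hround' : ∀ a e, a ≤ e → e - a ≤ r → ∃ good g : ℕ, Representable b good ∧ good - 1 = g ∧
      c a + g ≤ c e ∧ (c e : ℝ) - c a ≤ g + E := by
    intro a e hae her
    have h1 : c e ≤ c a + (e - a) := prefixCount_le θ u hae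
    have h2 : c a ≤ c e := prefixCount_mono θ u hae
    obtain ⟨w, hw1, hw2, hw3⟩ := hround (c e - c a + 1) (by omega)
    refine ⟨w, w - 1, hw1, rfl, by omega, ?_⟩
    have h3 : (w : ℝ) ≤ (w - 1 : ℕ) + 1 := by exact_mod_cast (show w ≤ w - 1 + 1 by omega)
    have h4 : ((c e - c a + 1 : ℕ) : ℝ) = c e - c a + 1 := by
      rw [Nat.cast_add, Nat.cast_sub h2, Nat.cast_one]
    linarith
  have hwin : ∀ q < 3, (c ((q + 1) * r) : ℝ) - c (q * r) < G - 15 * E := by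
    intro q hq
    obtain ⟨good, g, h1, h2, h3, h4⟩ := hround' (q * r) ((q + 1) * r)
      (Nat.mul_le_mul_right _ (Nat.le_succ q)) (by rw [← Nat.sub_mul]; simp)
    obtain ⟨t, ht⟩ := S.window hσ hq h1 h2 h4r h3
    have := ht.trans_lt (hfail t)
    rw [← hu, ← hN] at this
    linarith
  have w₀ : (c r : ℝ) < G - 15 * E := by simpa [hc0] using hwin 0 (by norm_num)
  have w₁ : (c (2 * r) : ℝ) - c r < G - 15 * E := by simpa using hwin 1 (by norm_num)
  have w₂ : (c (3 * r) : ℝ) - c (2 * r) < G - 15 * E := hwin 2 (by norm_num)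
  have v₀ : (c (3 * r + L + R) : ℝ) - c (3 * r) < G - 15 * E := by
    obtain ⟨good, g, h1, h2, h3, h4⟩ := hround' (3 * r) (3 * r + L + R) (by omega) (by omega)
    obtain ⟨t, ht⟩ := S.first_chunks hσ h1 hL hR h2 hLRr h4r h3
    have := ht.trans_lt (hfail t)
    rw [← hu, ← hN] at this
    rcases min_cases ((g : ℝ) / 2) (g + ((N : ℝ) - 5 * r) / 2) with ⟨h5, -⟩ | ⟨h5, -⟩ <;>
      rw [h5] at this <;> linarith
  obtain ⟨t₂, l, hl, ht₂⟩ := S.last_chunks hσ hL (by omega) h4r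
  have v₂ := ht₂.trans_lt (hfail t₂)
  rw [← hu, ← hN] at v₂ hl
  -- Either bound on `l` suffices: `r` is about `27 / 121 * m`, and `N - 3 * r - L` is at least
  -- `(121 - 81 - 14) / 121 * m`.
  have hl1 : 26 / 121 * (m : ℝ) - E ≤ l := by
    rcases min_choice r (N - (3 * r + L)) with h | h
    · rw [hl, h]; linarith
    · rw [hl, h, Nat.cast_sub (by omega)]
      push_cast
      linarith
  -- The 2-items for which no reserved bin is left are all treated as large, the worst case for the
  -- count.
  have hD : (c N : ℝ) - c (3 * r + L + l) ≤ N - (3 * r + L) - l := by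
    have h1 : c N ≤ c (3 * r + L + l) + (N - (3 * r + L + l)) :=
      prefixCount_le θ u (by omega)
    have h2 : c N + (3 * r + L + l) ≤ c (3 * r + L + l) + N := by omega
    have h3 : (c N : ℝ) + (3 * r + L + l) ≤ c (3 * r + L + l) + N := by exact_mod_cast h2
    linarith
  have hv₂ : 2 * ((c (3 * r + L + l) : ℝ) - c (3 * r + L)) - l < G - 15 * E := by linarith
  have hbad := chunk_arith hE1 hmN' hG hGE hr2 hR2 hjm hcN w₀ w₁ w₂ hv₂ hl1 hD
  have hmono : c (3 * r) ≤ c (3 * r + L) := prefixCount_mono θ u (by omega)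
  have hle : c (3 * r + L) ≤ c (3 * r) + (3 * r + L - 3 * r) := prefixCount_le θ u (by omega)
  obtain ⟨g, hg, hg1, hg2⟩ := hround (c (3 * r + L) - c (3 * r)) (by omega)
  rw [Nat.cast_sub hmono] at hg2
  -- The margin `2 * E` in `hbad` absorbs the rounding of the number of good items.
  have hgR : L - g ≤ R := by
    have h1 : (L : ℝ) ≤ R + g := by linarith
    have : L ≤ R + g := by exact_mod_cast h1
    omega
  obtain ⟨t₁, l', hl', ht₁⟩ := S.outer_chunks hσ hg hL hR hLRr hgR h4r
    (show c (3 * r) + g ≤ c (3 * r + L) by omega)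
  have v₁ := ht₁.trans_lt (hfail t₁)
  rw [← hu, ← hN] at v₁ hl'
  have hl1' : 13 / 121 * (m : ℝ) - E ≤ l' := by
    rcases min_choice (r - L) (N - (3 * r + L + R)) with h | h
    · rw [hl', h, Nat.cast_sub (by omega)]; linarith
    · rw [hl', h, Nat.cast_sub (by omega)]
      push_cast
      linarith
  have hD' : (c N : ℝ) - c (3 * r + L + R + l') ≤ N - (3 * r + L + R) - l' := by
    have h1 : c N ≤ c (3 * r + L + R + l') + (N - (3 * r + L + R + l')) :=
      prefixCount_le θ u (by omega)
    have h2 : c N + (3 * r + L + R + l') ≤ c (3 * r + L + R + l') + N := by omega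
    have h3 : (c N : ℝ) + (3 * r + L + R + l') ≤ c (3 * r + L + R + l') + N := by
      exact_mod_cast h2
    linarith
  have hv₁ : ((c (3 * r + L) : ℝ) - c (3 * r)) +
      2 * (c (3 * r + L + R + l') - c (3 * r + L + R)) - l' < G - 15 * E := by linarith
  exact chunk_contradiction hE1 hmN' hG hGE hr2 hL2 hR2 hjm hcN w₀ w₁ w₂ v₀ hv₂ hl1 hD hv₁ hl1' hD'

/-! ### Choice of the parameters -/

/-- The number of bins covered with suitable advice of precision `b`. -/
theorem exists_tape_covered {σ : List ℝ} (hσ : IsInput σ) {b : ℕ} (hb : 1 ≤ b)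
    (hn : σ.length < 2 ^ (2 ^ b)) :
    ∃ t : Tape, 135 / 242 * (opt σ : ℝ) - 600 * ((opt σ : ℝ) * (2 / 2 ^ b) + 1) ≤
      (modifiedDualHarmonic.covered (selfDelimited b t) σ : ℝ) := by
  obtain ⟨m, k, hopt, hmopt, hmN, hk, hsupply⟩ := opt_structure σ hσ
  have hNn := length_twos_le σ
  set u := twos σ with hu
  set N := u.length with hN
  set ε : ℝ := 2 / 2 ^ b with hε
  have hε0 : 0 ≤ ε := by positivity
  have hε1 : ε ≤ 1 := by
    rw [hε, div_le_one (by positivity)]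
    calc (2 : ℝ) = 2 ^ 1 := by norm_num
      _ ≤ 2 ^ b := pow_le_pow_right₀ (by norm_num) hb
  -- `E - 1` bounds the error of writing an integer up to `m` with `b` significant bits; the
  -- additional 1 absorbs integer division.
  obtain ⟨E, hE⟩ : ∃ E : ℝ, E = m * ε + 1 := ⟨_, rfl⟩
  -- `G` is twice the gain over `N / 2` that yields `135 / 484 * (m + N)`, the part of the target
  -- due to the 2-items.
  obtain ⟨G, hG⟩ : ∃ G : ℝ, G = 135 / 242 * ((m : ℝ) + N) - N := ⟨_, rfl⟩
  have hE1 : 1 ≤ E := by rw [hE]; have : 0 ≤ m * ε := by positivity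
                         linarith
  have hmul : ∀ v : ℕ, v ≤ m → (v : ℝ) * ε ≤ E - 1 := fun v hv => by
    rw [hE, add_sub_cancel_right]
    exact mul_le_mul_of_nonneg_right (by exact_mod_cast hv) hε0
  have hoptR : 2 * (opt σ : ℝ) ≤ N + m + 2 * k := by exact_mod_cast hopt
  have hEopt : E ≤ (opt σ : ℝ) * ε + 1 := by
    have := mul_le_mul_of_nonneg_right (show (m : ℝ) ≤ opt σ by exact_mod_cast hmopt) hε0
    rw [hE]; linarith
  have hmN' : (m : ℝ) ≤ N := by exact_mod_cast hmN
  have hk0 : (0 : ℝ) ≤ k := k.cast_nonneg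
  -- If the required gain is of the order of the rounding error, separate packing suffices.
  rcases le_or_gt G (1000 * E) with hGE | hGE
  · obtain ⟨t, ht⟩ := (goodForSmall_zero (b := b) hσ hk).plain hσ
    refine ⟨t, le_trans ?_ ht⟩
    rw [← hu, ← hN]
    linarith
  suffices h : ∃ t : Tape, (N : ℝ) / 2 + G / 2 + 2 / 3 * k - 20 * E ≤
      (modifiedDualHarmonic.covered (selfDelimited b t) σ : ℝ) by
    obtain ⟨t, ht⟩ := h
    refine ⟨t, le_trans ?_ ht⟩
    linarith
  have hround : ∀ v : ℕ, v ≤ m → ∃ w, Representable b w ∧ w ≤ v ∧ (v : ℝ) ≤ w + (E - 1) := by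
    intro v hv
    obtain ⟨w, h1, h2, h3⟩ := exists_representable (v := v) hb (by omega)
    exact ⟨w, h1, h2, h3.trans (by have := hmul v hv; linarith)⟩
  obtain ⟨r, hr, hrm, hrm'⟩ := hround (27 * m / 121) (by omega)
  obtain ⟨L, hL, hLr, hLr'⟩ := hround (14 * r / 27) (by omega)
  obtain ⟨R, hR, hRr, hRr'⟩ := hround (13 * r / 27) (by omega)
  have hr1 : (r : ℝ) ≤ 27 / 121 * m := by
    have : 121 * r ≤ 27 * m := by omega
    have : 121 * (r : ℝ) ≤ 27 * m := by exact_mod_cast this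
    linarith
  have hr2 : 27 / 121 * (m : ℝ) - E ≤ r := by
    have : 27 * m ≤ 121 * (27 * m / 121) + 121 := by omega
    have : 27 * (m : ℝ) ≤ 121 * (27 * m / 121 : ℕ) + 121 := by exact_mod_cast this
    linarith
  have hL1 : (L : ℝ) ≤ 14 / 27 * r := by
    have : 27 * L ≤ 14 * r := by omega
    have : 27 * (L : ℝ) ≤ 14 * r := by exact_mod_cast this
    linarith
  have hL2 : 14 / 27 * (r : ℝ) - E ≤ L := by
    have : 14 * r ≤ 27 * (14 * r / 27) + 27 := by omega
    have : 14 * (r : ℝ) ≤ 27 * (14 * r / 27 : ℕ) + 27 := by exact_mod_cast this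
    linarith
  have hR1 : (R : ℝ) ≤ 13 / 27 * r := by
    have : 27 * R ≤ 13 * r := by omega
    have : 27 * (R : ℝ) ≤ 13 * r := by exact_mod_cast this
    linarith
  have hR2 : 13 / 27 * (r : ℝ) - E ≤ R := by
    have : 13 * r ≤ 27 * (13 * r / 27) + 27 := by omega
    have : 13 * (r : ℝ) ≤ 27 * (13 * r / 27 : ℕ) + 27 := by exact_mod_cast this
    linarith
  have hrε := hmul r (by omega)
  have hj0 : 1 ≤ (m : ℝ) - 2 * r - 2 - 2 * (r * ε) := by linarith
  -- Discarding the at most `j` bins with a 2-item above `θ` must leave `2 * r` supplying bins and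
  -- the margin for rounding required by `exists_small_advice`.
  obtain ⟨j, hj⟩ : ∃ j : ℕ, j = ⌊(m : ℝ) - 2 * r - 2 - 2 * (r * ε)⌋₊ := ⟨_, rfl⟩
  have hj1 : (j : ℝ) ≤ (m : ℝ) - 2 * r - 2 - 2 * (r * ε) := hj ▸ Nat.floor_le (by linarith)
  have hj2 : (m : ℝ) - 2 * r - 2 - 2 * (r * ε) < j + 1 := hj ▸ Nat.lt_floor_add_one _
  have hj3 : 0 < j := by
    have : (0 : ℝ) < j := by linarith
    exact_mod_cast this
  have hrε0 : 0 ≤ (r : ℝ) * ε := by positivity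
  have hr0 : (0 : ℝ) ≤ r := r.cast_nonneg
  have hrm3 : 2 * r + 3 ≤ m := by
    have : 2 * (r : ℝ) + 3 ≤ m := by linarith
    exact_mod_cast this
  have hjN : j ≤ N := by
    have : (j : ℝ) ≤ N := by linarith
    exact_mod_cast this
  obtain ⟨θ, hθu, hjθ, hθJ⟩ := exists_threshold u hj3 hjN
  have hθ1 : θ < 1 := (hσ θ (mem_of_mem_twos hθu)).2
  have hθ2 : 1 / 2 ≤ θ := half_le_of_mem_twos hθu
  obtain ⟨x, hx, hx2, hx3⟩ := exists_fixed_point b (v := 1 - θ) (by linarith) (by linarith)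
  obtain ⟨M, B, hmM, hMm, hBM, hs⟩ := hsupply θ j (((x : ℝ) + 1) / 2 ^ b) hθ1 hθJ
  have hM : 2 * (r : ℝ) + 2 + 2 * r * (2 / 2 ^ b) ≤ M := by
    have : (m : ℝ) ≤ M + j := by exact_mod_cast hmM
    rw [← hε]
    linarith
  obtain ⟨black, y, hblack, hy, hsm⟩ := exists_small_advice hb (by omega) hr hθ1 hx3 hBM hM hs
  have S : GoodForSmall σ b k r θ black x y :=
    ⟨hr, hblack, hx, hy, hx2, fun _ _ _ _ _ => hsm _ rfl rfl rfl rfl⟩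
  have h4r : 4 * r ≤ N := by omega
  have hLRr : L + R ≤ r := by omega
  have hcN : (j : ℝ) ≤ prefixCount θ u N := by
    have : j ≤ prefixCount θ u N := by rw [prefixCount, hN, List.take_length]; exact hjθ
    exact_mod_cast this
  exact S.exists_tape hσ hround hL hR hE1 hmN' (by omega) h4r hLRr hG hGE hr1 hr2 hL1 hL2 hR1 hR2
    hrε (by linarith) hcN

/-! ### Asymptotics in the input length -/

theorem opt_le_length (σ : List ℝ) : opt σ ≤ σ.length := by
  unfold opt
  refine Finset.sup_le fun f _ => ?_
  unfold numCovered
  calc _ ≤ (Finset.univ : Finset (Fin σ.length)).card := Finset.card_le_card (Finset.subset_univ _)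
    _ = σ.length := by simp

theorem one_lt_logb {n : ℕ} (hn : 3 ≤ n) : 1 < Real.logb 2 n := by
  rw [Real.lt_logb_iff_rpow_lt one_lt_two (by positivity)]
  have : (3 : ℝ) ≤ n := by exact_mod_cast hn
  norm_num
  linarith

/-- Only the weaker bound `2 ^ b > log n` is drawn from this, which holds because `log n > 1`. -/
theorem sq_logb_le_two_pow_approxBits {n : ℕ} (hn : 3 ≤ n) :
    Real.logb 2 n ^ 2 ≤ 2 ^ approxBits n := by
  have h1 := one_lt_logb hn
  have h2 : 2 * Real.logb 2 (Real.logb 2 n) ≤ approxBits n := Nat.le_ceil _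
  calc Real.logb 2 n ^ 2 = (2 : ℝ) ^ (2 * Real.logb 2 (Real.logb 2 n)) := by
        rw [mul_comm, Real.rpow_mul (by norm_num),
          Real.rpow_logb (by norm_num) (by norm_num) (by linarith), Real.rpow_two]
    _ ≤ (2 : ℝ) ^ (approxBits n : ℝ) := Real.rpow_le_rpow_of_exponent_le (by norm_num) h2
    _ = 2 ^ approxBits n := Real.rpow_natCast _ _

theorem logb_lt_two_pow_approxBits {n : ℕ} (hn : 3 ≤ n) :
    Real.logb 2 n < 2 ^ approxBits n := by
  have h1 := one_lt_logb hn
  have h2 := sq_logb_le_two_pow_approxBits hn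
  nlinarith

theorem one_le_approxBits {n : ℕ} (hn : 3 ≤ n) : 1 ≤ approxBits n := by
  by_contra! h
  have h1 := one_lt_logb hn
  have h2 := logb_lt_two_pow_approxBits hn
  rw [Nat.lt_one_iff.1 h] at h2
  norm_num at h2
  linarith

/-- This makes `b`-bit exponents sufficient, since all integers to be rounded are at most `n`. -/
theorem lt_two_pow_two_pow_approxBits {n : ℕ} (hn : 3 ≤ n) : n < 2 ^ (2 ^ approxBits n) := by
  have h := logb_lt_two_pow_approxBits hn
  have hn0 : (0 : ℝ) < n := by
    have : 0 < n := by omega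
    exact_mod_cast this
  rw [Real.logb_lt_iff_lt_rpow one_lt_two hn0] at h
  have e : ((2 : ℝ) ^ approxBits n) = ((2 ^ approxBits n : ℕ) : ℝ) := by push_cast; rfl
  rw [e, Real.rpow_natCast] at h
  exact_mod_cast h

theorem isBigO_adviceBits : (fun n : ℕ => ((15 * approxBits n + 6 : ℕ) : ℝ)) =O[atTop]
    fun n : ℕ => Real.logb 2 (Real.logb 2 (n : ℝ)) := by
  -- With `x = log log n ≥ 1`, `15 * (2 * x + 1) + 6 ≤ 51 * x`.
  refine IsBigO.of_bound 51 ?_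
  filter_upwards [eventually_ge_atTop 4] with n hn
  have h1 : 2 ≤ Real.logb 2 n := by
    rw [Real.le_logb_iff_rpow_le one_lt_two (by positivity)]
    have : (4 : ℝ) ≤ n := by exact_mod_cast hn
    norm_num
    linarith
  have h2 : 1 ≤ Real.logb 2 (Real.logb 2 n) := by
    rw [Real.le_logb_iff_rpow_le one_lt_two (by linarith)]
    norm_num
    linarith
  have h3 : (approxBits n : ℝ) < 2 * Real.logb 2 (Real.logb 2 n) + 1 :=
    Nat.ceil_lt_add_one (by linarith)
  rw [Real.norm_of_nonneg (by positivity), Real.norm_of_nonneg (by linarith)]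
  push_cast
  linarith

theorem isBigO_error : (fun n : ℕ => 1200 / (2 : ℝ) ^ approxBits n) =O[atTop]
    fun n : ℕ => 1 / Real.logb 2 (n : ℝ) := by
  refine IsBigO.of_bound 1200 ?_
  filter_upwards [eventually_ge_atTop 3] with n hn
  have h1 := one_lt_logb hn
  have h2 := logb_lt_two_pow_approxBits hn
  rw [Real.norm_of_nonneg (by positivity), Real.norm_of_nonneg (by positivity), mul_one_div]
  exact div_le_div_of_nonneg_left (by norm_num) (by linarith) h2.le

end BinCovering

/-- The modified Dual Harmonic strategy with `b = 2 log log n` uses `O(log log n)` advice bits and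
has asymptotic competitive ratio at least `135/242 - O(1 / log n)`. -/
theorem theorem1 :
    ∃ (adviceBits : ℕ → ℕ) (err : ℕ → ℝ) (C : ℝ),
      (fun n : ℕ => (adviceBits n : ℝ)) =O[Filter.atTop]
        (fun n : ℕ => Real.logb 2 (Real.logb 2 (n : ℝ))) ∧
      err =O[Filter.atTop] (fun n : ℕ => 1 / Real.logb 2 (n : ℝ)) ∧
      ∀ σ : List ℝ, BinCovering.IsInput σ →
        ∃ t : BinCovering.Tape,
          BinCovering.modifiedDualHarmonic.bitsRead
              (BinCovering.selfDelimited (BinCovering.approxBits σ.length) t) σ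
            ≤ (adviceBits σ.length : ℕ∞) ∧
          (135 / 242 - err σ.length) * (BinCovering.opt σ : ℝ) - C
            ≤ (BinCovering.modifiedDualHarmonic.covered
                (BinCovering.selfDelimited (BinCovering.approxBits σ.length) t) σ : ℝ) := by
  refine ⟨fun n => 15 * BinCovering.approxBits n + 6,
    fun n => 1200 / (2 : ℝ) ^ BinCovering.approxBits n, 600, BinCovering.isBigO_adviceBits,
    BinCovering.isBigO_error, fun σ hσ => ?_⟩
  have hbits : ∀ t : BinCovering.Tape, BinCovering.modifiedDualHarmonic.bitsRead
      (BinCovering.selfDelimited (BinCovering.approxBits σ.length) t) σ ≤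
        ((15 * BinCovering.approxBits σ.length + 6 : ℕ) : ℕ∞) :=
    fun t => (BinCovering.readLength_selfDelimited _ t).le
  rcases le_or_gt 3 σ.length with hn | hn
  · obtain ⟨t, ht⟩ := BinCovering.exists_tape_covered hσ (BinCovering.one_le_approxBits hn)
      (BinCovering.lt_two_pow_two_pow_approxBits hn)
    refine ⟨t, hbits t, le_trans (le_of_eq ?_) ht⟩
    ring
  -- For at most two items the optimum is at most 2, and the additive constant makes the bound
  -- trivial for any tape.
  · refine ⟨fun _ => false, hbits _, le_trans ?_ (Nat.cast_nonneg _)⟩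
    have h1 : (BinCovering.opt σ : ℝ) ≤ 2 := by
      exact_mod_cast (BinCovering.opt_le_length σ).trans (Nat.le_of_lt_succ hn)
    have h2 : 0 ≤ 1200 / (2 : ℝ) ^ BinCovering.approxBits σ.length * BinCovering.opt σ := by
      positivity
    rw [sub_mul]
    linarith
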